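/- Let $a,b>-1$ be real and $X\in\mathbb C$, and write $x!=\Gamma(x+1)$, $(x)_k=x(x+1)\cdots(x+k-1)$. For complex polynomials $f,g$ put $$\langle f,g\rangle_1=\tfrac12\int_{-1}^1\!\int_{-1}^1 f(y)g(z)\,\mathrm{sgn}(z-y)\,w_1(y)w_1(z)\,dz\,dy,\quad \langle f,g\rangle_4=\tfrac12\int_{-1}^1\bigl(f(z)g'(z)-f'(z)g(z)\bigr)w_4(z)\,dz,$$ with $w_1(z)=(1-z)^{(a-1)/2}(1+z)^{(b-1)/2}$, $w_4(z)=(1-z)^{a+1}(1+z)^{b+1}$, and $\langle f,g\rangle_X=X^2\langle f,g\rangle_1+\langle f,g\rangle_4$. Let $p_n$ be the monic Jacobi polynomial of degree $n$ for the weight $(1-z)^a(1+z)^b$ on $(-1,1)$, that is, $$p_n(z)=\frac{2^n(a+1)_n}{(n+a+b+1)_n}\,{}_2F_1\!\left(-n,\,n+a+b+1;\,a+1;\,\tfrac{1-z}2\right),$$ let $p_{-1}=0$, and for $j\ge 0$ put $$\zeta_j=\frac{8j(2j+a)(2j+b)(2j+a+b)}{(4j+a+b-1)(4j+a+b)(4j+a+b+1)(4j+a+b+2)}\quad(\zeta_0=0),$$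 $$h^{(1)}_j=2^{a+b+4j+2}\frac{\Gamma(2j+1)\Gamma(2j+a+1)\Gamma(2j+b+1)\Gamma(2j+a+b+1)}{\Gamma(4j+a+b+1)\Gamma(4j+a+b+3)},$$ $$h^{(4)}_j=2^{a+b+2j+2}\frac{\Gamma(j+2)\Gamma(j+a+2)\Gamma(j+b+2)\Gamma(j+a+b+2)}{\Gamma(2j+a+b+2)\Gamma(2j+a+b+4)},$$ where $\Gamma(2j+a+b+1)/\Gamma(4j+a+b+1)$ is read as $1$ for $j=0$. Put $q_n=p_{2n+1}-\zeta_np_{2n-1}$. The Wilson polynomials are $$\tilde W_n(y;A,B,C,D)=\sum_{k=0}^n\frac{(-n)_k(n+A+B+C+D-1)_k\prod_{l=0}^{k-1}\bigl((A+l)^2+y\bigr)}{(A+B)_k(A+C)_k(A+D)_k\,k!}.$$ Define, for $j\ge0$, $$\alpha_j=2^{-2j}\frac{(4j+a+b+1)!}{(2j)!\,(2j+b)!}\,\tilde W_j\!\left(-\tfrac{X^2}{4};\tfrac{a+1}2,\tfrac{b+1}2,\tfrac12,0\right),\qquad \xi_j=\alpha_j\,\frac{4j+a+b+2}{a+b+2}.$$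 Then: 1. For all $m,n\ge0$: $\langle p_{2m},q_n\rangle_1=h^{(1)}_n\delta_{m,n}$, $\langle p_{2m},p_{2n}\rangle_1=\langle q_m,q_n\rangle_1=0$, $\langle p_{2m},p_{2n+1}\rangle_4=h^{(4)}_{2n}\delta_{m,n}-h^{(4)}_{2m-1}\delta_{m,n+1}$, and $\langle p_{2m},p_{2n}\rangle_4=\langle p_{2m+1},p_{2n+1}\rangle_4=0$. 2. $\alpha_0=\xi_0=\Gamma(a+b+2)/\Gamma(b+1)$. The sequence $(\alpha_j/\alpha_0)_{j\ge0}$ is the unique solution, with value $1$ at $j=0$ and value $0$ at $j=-1$, of $$h^{(4)}_{2j+1}A_{j+1}-\bigl(X^2h^{(1)}_j+h^{(4)}_{2j}+\zeta_jh^{(4)}_{2j-1}\bigr)A_j+\zeta_jh^{(4)}_{2j-2}A_{j-1}=0\qquad(j\ge0),$$ and $(\xi_j/\xi_0)_{j\ge0}$ is the unique solution, with the same initial values, of $$\zeta_{j+1}h^{(4)}_{2j}A_{j+1}-\bigl(X^2h^{(1)}_j+h^{(4)}_{2j}+\zeta_jh^{(4)}_{2j-1}\bigr)A_j+h^{(4)}_{2j-1}A_{j-1}=0\qquad(j\ge0)$$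 (for $j=0$ the terms with $\zeta_0$ or $A_{-1}$ are absent). 3. For all $j\ge0$, $$\tilde W_j\!\left(-\tfrac{X^2}{4};\tfrac{a+1}2,\tfrac{b+1}2,\tfrac12,0\right)={}_4F_3\!\left(\begin{matrix}-j,\ j+\frac{a+b+1}2,\ \frac{a+1-X}2,\ \frac{a+1+X}2\\ \frac{a+1}2,\ \frac{a+2}2,\ \frac{a+b+2}2\end{matrix}\,\Big|\,1\right),$$ $$\xi_j=2^{-2j}\frac{(4j+a+b+2)!}{(2j)!\,(2j+b)!\,(a+b+2)}\,\tilde W_j\!\left(-\tfrac{X^2}{4};\tfrac{a+1}2,\tfrac{b+1}2,\tfrac12,0\right).$$ 4. If $X$ is real, then $\alpha_j\ne0$ for all $j$. Whenever $\alpha_j\neq0$ for all $j$, the polynomials $$Q_{2m}=\frac1{\alpha_m}\sum_{k=0}^m\alpha_kp_{2k},\qquad Q_{2m+1}=\frac1{\xi_m}\sum_{k=0}^m\xi_k\,(p_{2k+1}-\zeta_kp_{2k-1})\qquad(m\ge0)$$ are monic with $\deg Q_n=n$, and are skew orthogonal: for all $m,n\ge0$, $\langle Q_{2m},Q_{2n}\rangle_X=\langle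 Q_{2m+1},Q_{2n+1}\rangle_X=0$ and $\langle Q_{2m},Q_{2n+1}\rangle_X=u_m\delta_{m,n}$ with $u_m=h^{(4)}_{2m+1}\alpha_{m+1}/\alpha_m$. They are the only such polynomials up to the usual freedom: if $(R_n)_{n\ge0}$ is any family of monic polynomials with $\deg R_n=n$ satisfying these relations for some numbers $u_m$, then for every $m$ one has $R_{2m}=Q_{2m}$ and $R_{2m+1}=Q_{2m+1}+c\,Q_{2m}$ for some constant $c$. -/

import Mathlib

open MeasureTheory Set

/-- The rising factorial `(x)_k = x (x + 1) ⋯ (x + k - 1)`. -/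
noncomputable def risingFactorial {R : Type*} [CommRing R] (x : R) (k : ℕ) : R :=
  (ascPochhammer R k).eval x

/-- The generalised hypergeometric series `₄F₃(a₁, a₂, a₃, a₄; b₁, b₂, b₃; z)`. -/
noncomputable def hypergeometric4F3 (a₁ a₂ a₃ a₄ b₁ b₂ b₃ z : ℂ) : ℂ :=
  ∑' k : ℕ,
    (risingFactorial a₁ k * risingFactorial a₂ k * risingFactorial a₃ k * risingFactorial a₄ k) /
      (risingFactorial b₁ k * risingFactorial b₂ k * risingFactorial b₃ k) *
      z ^ k / (k.factorial : ℂ)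

/-- The Wilson polynomial
`W̃ₙ(y; a, b, c, d) = Wₙ(y; a, b, c, d) / ((a + b)ₙ (a + c)ₙ (a + d)ₙ)`, as a polynomial in the
variable `y = x²`; here `(a + i x)_k (a - i x)_k = ∏_{l < k} ((a + l)² + y)`. -/
noncomputable def wilson (n : ℕ) (y a b c d : ℂ) : ℂ :=
  ∑ k ∈ Finset.range (n + 1),
    risingFactorial (-(n : ℂ)) k * risingFactorial ((n : ℂ) + a + b + c + d - 1) k *
      (∏ l ∈ Finset.range k, ((a + (l : ℂ)) ^ 2 + y)) /
      (risingFactorial (a + b) k * risingFactorial (a + c) k * risingFactorial (a + d) k *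
        (k.factorial : ℂ))

/-- The weight `(1 - z)^a (1 + z)^b`, to be used on the interval `(-1, 1)`. -/
noncomputable def jacobiWeight (a b z : ℝ) : ℝ := (1 - z) ^ a * (1 + z) ^ b

/-- The monic Jacobi polynomial of degree `n`, orthogonal for the weight `(1 - z)^a (1 + z)^b`:
`2ⁿ (a + 1)ₙ / (n + a + b + 1)ₙ · ₂F₁(-n, n + a + b + 1; a + 1; (1 - z) / 2)`. -/
noncomputable def jacobiMonic (a b : ℝ) (n : ℕ) : Polynomial ℝ :=
  Polynomial.C (2 ^ n * risingFactorial (a + 1) n / risingFactorial ((n : ℝ) + a + b + 1) n) *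
    ∑ k ∈ Finset.range (n + 1),
      Polynomial.C (risingFactorial (-(n : ℝ)) k * risingFactorial ((n : ℝ) + a + b + 1) k /
        (risingFactorial (a + 1) k * (k.factorial : ℝ))) *
        (Polynomial.C (1 / 2) * (1 - Polynomial.X)) ^ k

/-- The monic Jacobi polynomial regarded as a complex polynomial. -/
noncomputable def jacobiPoly (a b : ℝ) (n : ℕ) : Polynomial ℂ :=
  (jacobiMonic a b n).map (algebraMap ℝ ℂ)

/-- The skew inner product `⟨f, g⟩₁` with `e^{-V₁(z)} = (1 - z)^((a-1)/2) (1 + z)^((b-1)/2)`. -/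
noncomputable def skewOne (a b : ℝ) (f g : Polynomial ℂ) : ℂ :=
  1 / 2 * ∫ y in Ioo (-1 : ℝ) 1, ∫ z in Ioo (-1 : ℝ) 1,
    f.eval (y : ℂ) * g.eval (z : ℂ) *
      ((Real.sign (z - y) * jacobiWeight ((a - 1) / 2) ((b - 1) / 2) y *
        jacobiWeight ((a - 1) / 2) ((b - 1) / 2) z : ℝ) : ℂ)

/-- The skew inner product `⟨f, g⟩₄` with `e^{-2V₂(z)} = (1 - z)^(a+1) (1 + z)^(b+1)`. -/
noncomputable def skewFour (a b : ℝ) (f g : Polynomial ℂ) : ℂ :=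
  1 / 2 * ∫ z in Ioo (-1 : ℝ) 1,
    (f.eval (z : ℂ) * g.derivative.eval (z : ℂ) - f.derivative.eval (z : ℂ) * g.eval (z : ℂ)) *
      ((jacobiWeight (a + 1) (b + 1) z : ℝ) : ℂ)

/-- The skew inner product `⟨f, g⟩_X = X² ⟨f, g⟩₁ + ⟨f, g⟩₄`. -/
noncomputable def skewMixed (a b : ℝ) (X : ℂ) (f g : Polynomial ℂ) : ℂ :=
  X ^ 2 * skewOne a b f g + skewFour a b f g

/-- The coefficient `ζ_j` (it is `0` for `j = 0`). -/
noncomputable def jacobiZeta (a b : ℝ) (j : ℕ) : ℝ :=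
  8 * j * (2 * j + a) * (2 * j + b) * (2 * j + a + b) /
    ((4 * j + a + b - 1) * (4 * j + a + b) * (4 * j + a + b + 1) * (4 * j + a + b + 2))

/-- The norm `h⁽¹⁾_j`; the quotient `Γ(2j+a+b+1) / Γ(4j+a+b+1)` is `1` for `j = 0`, also where
both Gamma functions have a pole. -/
noncomputable def jacobiNormOne (a b : ℝ) (j : ℕ) : ℝ :=
  (2 : ℝ) ^ (a + b + 4 * j + 2) *
    (Real.Gamma (2 * j + 1) * Real.Gamma (2 * j + a + 1) * Real.Gamma (2 * j + b + 1)) /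
    Real.Gamma (4 * j + a + b + 3) *
    (if j = 0 then 1 else Real.Gamma (2 * j + a + b + 1) / Real.Gamma (4 * j + a + b + 1))

/-- The norm `h⁽⁴⁾_j`. -/
noncomputable def jacobiNormFour (a b : ℝ) (j : ℕ) : ℝ :=
  (2 : ℝ) ^ (a + b + 2 * j + 2) *
    (Real.Gamma (j + 2) * Real.Gamma (j + a + 2) * Real.Gamma (j + b + 2) *
      Real.Gamma (j + a + b + 2)) /
    (Real.Gamma (2 * j + a + b + 2) * Real.Gamma (2 * j + a + b + 4))

/-- The polynomial `p_{2n+1} - ζ_n p_{2n-1}`, where `p_{-1} = 0`. -/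
noncomputable def jacobiOdd (a b : ℝ) : ℕ → Polynomial ℂ
  | 0 => jacobiPoly a b 1
  | n + 1 => jacobiPoly a b (2 * n + 3) -
      Polynomial.C ((jacobiZeta a b (n + 1) : ℝ) : ℂ) * jacobiPoly a b (2 * n + 1)

/-- The recurrence
`h⁽⁴⁾_{2j+1} A_{j+1} - (X² h⁽¹⁾_j + h⁽⁴⁾_{2j} + ζ_j h⁽⁴⁾_{2j-1}) A_j + ζ_j h⁽⁴⁾_{2j-2} A_{j-1} = 0`
for `j ≥ 0`, with `A_{-1} = 0` (and `ζ_0 = 0`). -/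
def EvenRecurrence (a b : ℝ) (X : ℂ) (A : ℕ → ℂ) : Prop :=
  jacobiNormFour a b 1 * A 1 - (X ^ 2 * jacobiNormOne a b 0 + jacobiNormFour a b 0) * A 0 = 0 ∧
  ∀ j : ℕ,
    jacobiNormFour a b (2 * j + 3) * A (j + 2) -
      (X ^ 2 * jacobiNormOne a b (j + 1) + jacobiNormFour a b (2 * j + 2) +
        jacobiZeta a b (j + 1) * jacobiNormFour a b (2 * j + 1)) * A (j + 1) +
      jacobiZeta a b (j + 1) * jacobiNormFour a b (2 * j) * A j = 0

/-- The recurrence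
`ζ_{j+1} h⁽⁴⁾_{2j} B_{j+1} - (X² h⁽¹⁾_j + h⁽⁴⁾_{2j} + ζ_j h⁽⁴⁾_{2j-1}) B_j + h⁽⁴⁾_{2j-1} B_{j-1} = 0`
for `j ≥ 0`, with `B_{-1} = 0` (and `ζ_0 = 0`). -/
def OddRecurrence (a b : ℝ) (X : ℂ) (B : ℕ → ℂ) : Prop :=
  jacobiZeta a b 1 * jacobiNormFour a b 0 * B 1 -
    (X ^ 2 * jacobiNormOne a b 0 + jacobiNormFour a b 0) * B 0 = 0 ∧
  ∀ j : ℕ,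
    jacobiZeta a b (j + 2) * jacobiNormFour a b (2 * j + 2) * B (j + 2) -
      (X ^ 2 * jacobiNormOne a b (j + 1) + jacobiNormFour a b (2 * j + 2) +
        jacobiZeta a b (j + 1) * jacobiNormFour a b (2 * j + 1)) * B (j + 1) +
      jacobiNormFour a b (2 * j + 1) * B j = 0

/-- `W̃_j(-X²/4; (a+1)/2, (b+1)/2, 1/2, 0)`. -/
noncomputable def jacobiWilson (a b : ℝ) (X : ℂ) (j : ℕ) : ℂ :=
  wilson j (-X ^ 2 / 4) (((a : ℂ) + 1) / 2) (((b : ℂ) + 1) / 2) (1 / 2) 0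

/-- `α_j = 2^{-2j} (4j+a+b+1)! / ((2j)! (2j+b)!) · W̃_j(-X²/4; (a+1)/2, (b+1)/2, 1/2, 0)`, where
`x! = Γ(x + 1)`. -/
noncomputable def jacobiAlpha (a b : ℝ) (X : ℂ) (j : ℕ) : ℂ :=
  ((((2 : ℝ) ^ (2 * j))⁻¹ * Real.Gamma (4 * j + a + b + 2) /
    (((2 * j).factorial : ℝ) * Real.Gamma (2 * j + b + 1)) : ℝ) : ℂ) * jacobiWilson a b X j

/-- `ξ_j = α_j (4j+a+b+2) / (a+b+2)`. -/
noncomputable def jacobiXi (a b : ℝ) (X : ℂ) (j : ℕ) : ℂ :=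
  jacobiAlpha a b X j * (4 * j + a + b + 2) / (a + b + 2)

/-- `Q_{2m} = α_m⁻¹ ∑_{k ≤ m} α_k p_{2k}`. -/
noncomputable def skewPolyEven (a b : ℝ) (X : ℂ) (m : ℕ) : Polynomial ℂ :=
  Polynomial.C (1 / jacobiAlpha a b X m) *
    ∑ k ∈ Finset.range (m + 1), Polynomial.C (jacobiAlpha a b X k) * jacobiPoly a b (2 * k)

/-- `Q_{2m+1} = ξ_m⁻¹ ∑_{k ≤ m} ξ_k (p_{2k+1} - ζ_k p_{2k-1})`. -/
noncomputable def skewPolyOdd (a b : ℝ) (X : ℂ) (m : ℕ) : Polynomial ℂ :=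
  Polynomial.C (1 / jacobiXi a b X m) *
    ∑ k ∈ Finset.range (m + 1), Polynomial.C (jacobiXi a b X k) * jacobiOdd a b k

/-- The polynomials `Q_{2m} = E m` and `Q_{2m+1} = O m` form a family of monic skew orthogonal
polynomials for the form `B`, with `B (Q_{2m}, Q_{2m+1}) = u m`. -/
structure IsMonicSkewOrthogonal (B : Polynomial ℂ → Polynomial ℂ → ℂ)
    (E O : ℕ → Polynomial ℂ) (u : ℕ → ℂ) : Prop where
  even_monic : ∀ m, (E m).Monic
  even_natDegree : ∀ m, (E m).natDegree = 2 * m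
  odd_monic : ∀ m, (O m).Monic
  odd_natDegree : ∀ m, (O m).natDegree = 2 * m + 1
  even_odd : ∀ m n, B (E m) (O n) = if m = n then u m else 0
  even_even : ∀ m n, B (E m) (E n) = 0
  odd_odd : ∀ m n, B (O m) (O n) = 0

/-! Write w for the weight (1-z)^a(1+z)^b. Everything rests on one first-order operator,
`jacobiSkewOp`: D f = (1-X²)f' + ½((b-a)-(a+b+2)X)f, characterised by ((1-z²)w₁f)' = w₁·Df. Since w
= (1-z²)w₁² and w₄ = (1-z²)w, integration by parts shows that D is skew-adjoint for ∫fgw, that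
⟨f,g⟩₄ = ∫ f·Dg·w (`skewFour_eq`), and, the sign kernel being an antiderivative, that ⟨f,Dg⟩₁ =
-∫fgw (`skewOne_jacobiSkewOp`). So D represents the second form and inverts the first.

D raises degrees by one and is skew-adjoint, hence it maps p_n into the span of p_{n-1} and p_{n+1}
(`jacobiSkewOp_jacobiPoly_succ`), and q_n is a multiple of D p_{2n} (`jacobiOdd_eq`). All relations
between the p_n and the two forms follow from Jacobi orthogonality. In the basis p_{2k}, q_k the
mixed form vanishes on even-even and odd-odd pairs, and its even-odd block is tridiagonal
(`skewMixedBilin_even_odd`). A sum ∑α_k p_{2k} is therefore orthogonal to the lower q_n exactly when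
α satisfies a three-term recurrence; the transposed recurrence governs the odd sums.

These recurrences are rescalings of the recurrence of the Wilson polynomials in the degree. That one
is proved coefficient by coefficient in the basis ∏((A+l)²+y) (`wilsonCoeff_recurrence`,
`wilson_recurrence`), and the Gamma factor in α_j carries it over (`evenRecurrence_jacobiAlpha`);
the extra factor in ξ_j turns it into the transposed one (`oddRecurrence_jacobiXi`). For real X a
positivity invariant keeps α_j away from zero. Uniqueness holds because the form is nondegenerate on
polynomials of degree below 2m once the u_j are nonzero. -/

/-! ### Rising factorials. -/

section RisingFactorial

variable {R : Type*} [CommRing R]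

@[simp] lemma risingFactorial_zero (x : R) : risingFactorial x 0 = 1 := by
  simp [risingFactorial]

lemma risingFactorial_succ (x : R) (k : ℕ) :
    risingFactorial x (k + 1) = risingFactorial x k * (x + k) := by
  simp [risingFactorial, ascPochhammer_succ_eval]

lemma risingFactorial_succ_left (x : R) (k : ℕ) :
    risingFactorial x (k + 1) = x * risingFactorial (x + 1) k := by
  simp [risingFactorial, ascPochhammer_succ_left, Polynomial.eval_comp]

@[simp] lemma risingFactorial_one (x : R) : risingFactorial x 1 = x := by
  simp [risingFactorial]

lemma risingFactorial_eq_prod (x : R) (k : ℕ) :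
    risingFactorial x k = ∏ l ∈ Finset.range k, (x + l) := by
  induction k with
  | zero => simp
  | succ k ih => rw [risingFactorial_succ, ih, Finset.prod_range_succ]

lemma risingFactorial_neg_of_lt {n k : ℕ} (h : n < k) : risingFactorial (-(n : R)) k = 0 := by
  rw [risingFactorial_eq_prod]
  exact Finset.prod_eq_zero (Finset.mem_range.2 h) (by ring)

lemma risingFactorial_neg_self (n : ℕ) :
    risingFactorial (-(n : R)) n = (-1) ^ n * (n.factorial : R) := by
  induction n with
  | zero => simp
  | succ n ih =>
    rw [risingFactorial_succ_left, Nat.factorial_succ]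
    have : -((n + 1 : ℕ) : R) + 1 = -(n : R) := by push_cast; ring
    rw [this, ih]; push_cast; ring

lemma map_risingFactorial {S : Type*} [CommRing S] (f : R →+* S) (x : R) (k : ℕ) :
    f (risingFactorial x k) = risingFactorial (f x) k := by
  simp [risingFactorial_eq_prod, map_prod]

/-- Positivity of x is asked only for k ≠ 0 because of (n+a+b+1)_n: at n = 0 the base a+b+1 may be
negative or zero, but the product is empty. -/
lemma risingFactorial_pos {x : ℝ} {k : ℕ} (h : k ≠ 0 → 0 < x) : 0 < risingFactorial x k := by
  rcases k with _ | k
  · simp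
  · exact ascPochhammer_pos _ _ (h k.succ_ne_zero)

end RisingFactorial

/-! ### Monic Jacobi polynomials: differential equation, derivative, leading coefficient. -/

section JacobiAlgebra

open Polynomial

/-- The coefficients of `₂F₁(-n, n + a + b + 1; a + 1; t)`. -/
noncomputable def jacobiHypCoeff (a b : ℝ) (n k : ℕ) : ℝ :=
  risingFactorial (-(n : ℝ)) k * risingFactorial ((n : ℝ) + a + b + 1) k /
    (risingFactorial (a + 1) k * (k.factorial : ℝ))

/-- The polynomial `₂F₁(-n, n + a + b + 1; a + 1; t)`. -/
noncomputable def jacobiHyp (a b : ℝ) (n : ℕ) : ℝ[X] :=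
  ∑ k ∈ Finset.range (n + 1), C (jacobiHypCoeff a b n k) * X ^ k

lemma coeff_jacobiHyp (a b : ℝ) (n k : ℕ) :
    (jacobiHyp a b n).coeff k = jacobiHypCoeff a b n k := by
  simp only [jacobiHyp, finsetSum_coeff, coeff_C_mul, coeff_X_pow]
  by_cases hk : k ∈ Finset.range (n + 1)
  · simp [Finset.sum_ite_eq, hk]
  · have h : n < k := by simpa using hk
    simp [jacobiHypCoeff, risingFactorial_neg_of_lt h]

lemma jacobiMonic_eq_comp (a b : ℝ) (n : ℕ) :
    jacobiMonic a b n =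
      C (2 ^ n * risingFactorial (a + 1) n / risingFactorial ((n : ℝ) + a + b + 1) n) *
        (jacobiHyp a b n).comp (C (1 / 2) * (1 - X)) := by
  simp [jacobiMonic, jacobiHyp, jacobiHypCoeff, Polynomial.sum_comp]

/-- The ratio of consecutive hypergeometric coefficients, cross-multiplied. Read as an identity of
coefficients, it is the hypergeometric differential equation. -/
lemma jacobiHypCoeff_succ (a b : ℝ) (ha : -1 < a) (n k : ℕ) :
    ((k : ℝ) + 1) * (k + a + 1) * jacobiHypCoeff a b n (k + 1) =
      ((k : ℝ) - n) * (k + n + a + b + 1) * jacobiHypCoeff a b n k := by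
  have h1 : (k : ℝ) + a + 1 ≠ 0 := by have : (0 : ℝ) ≤ k := k.cast_nonneg; linarith
  have h2 : risingFactorial (a + 1) k ≠ 0 := (risingFactorial_pos fun _ => by linarith).ne'
  have h3 : (k.factorial : ℝ) ≠ 0 := by exact_mod_cast k.factorial_ne_zero
  have h4 : (k : ℝ) + 1 ≠ 0 := by positivity
  have h5 : a + 1 + (k : ℝ) ≠ 0 := by convert h1 using 1; ring
  simp only [jacobiHypCoeff, risingFactorial_succ, Nat.factorial_succ, Nat.cast_mul,
    Nat.cast_succ]
  field_simp
  ring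

lemma jacobiHyp_ode (a b : ℝ) (ha : -1 < a) (n : ℕ) :
    X * (1 - X) * derivative (derivative (jacobiHyp a b n)) +
      (C (a + 1) - C (a + b + 2) * X) * derivative (jacobiHyp a b n) =
      -C ((n : ℝ) * (n + a + b + 1)) * jacobiHyp a b n := by
  ext k
  have e : X * (1 - X) * derivative (derivative (jacobiHyp a b n)) +
      (C (a + 1) - C (a + b + 2) * X) * derivative (jacobiHyp a b n) =
      derivative (derivative (jacobiHyp a b n)) * X -
        derivative (derivative (jacobiHyp a b n)) * X * X +
      C (a + 1) * derivative (jacobiHyp a b n) -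
        C (a + b + 2) * (derivative (jacobiHyp a b n) * X) := by ring
  rw [e]
  have h := jacobiHypCoeff_succ a b ha n
  rcases k with _ | _ | k
  · have h0 := h 0
    simp only [coeff_add, coeff_sub, coeff_mul_X_zero, coeff_C_mul, coeff_derivative,
      coeff_jacobiHyp, neg_mul, coeff_neg]
    push_cast at h0 ⊢
    linarith
  · have h0 := h 1
    simp only [coeff_add, coeff_sub, coeff_mul_X_zero, coeff_C_mul, coeff_derivative, coeff_mul_X,
      coeff_jacobiHyp, neg_mul, coeff_neg]
    push_cast at h0 ⊢
    linarith
  · have h0 := h (k + 2)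
    simp only [coeff_add, coeff_sub, coeff_C_mul, coeff_derivative, coeff_mul_X,
      coeff_jacobiHyp, neg_mul, coeff_neg]
    push_cast at h0 ⊢
    linarith

lemma derivative_jacobiHyp (a b : ℝ) (ha : -1 < a) (n : ℕ) :
    derivative (jacobiHyp a b (n + 1)) =
      C (-((n : ℝ) + 1) * (n + a + b + 2) / (a + 1)) * jacobiHyp (a + 1) (b + 1) n := by
  ext k
  have h2 : risingFactorial (a + 1 + 1) k ≠ 0 := (risingFactorial_pos fun _ => by linarith).ne'
  have h3 : (k.factorial : ℝ) ≠ 0 := by exact_mod_cast k.factorial_ne_zero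
  have h4 : (k : ℝ) + 1 ≠ 0 := by positivity
  have h5 : a + 1 ≠ 0 := by linarith
  simp only [coeff_derivative, coeff_C_mul, coeff_jacobiHyp, jacobiHypCoeff,
    risingFactorial_succ_left _ k, Nat.factorial_succ, Nat.cast_mul, Nat.cast_succ]
  have e1 : -((n : ℝ) + 1) + 1 = -n := by ring
  have e2 : (n : ℝ) + 1 + a + b + 1 + 1 = n + (a + 1) + (b + 1) + 1 := by ring
  rw [e1, e2]
  field_simp
  ring

lemma derivative_half_sub :
    derivative (C (1 / 2 : ℝ) * (1 - X)) = -C (1 / 2) := by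
  simp

/-- The hypergeometric equation under the substitution t = (1-z)/2. It makes p_n an eigenfunction of
a self-adjoint operator, whence orthogonality. -/
lemma jacobiMonic_ode (a b : ℝ) (ha : -1 < a) (n : ℕ) :
    (1 - X ^ 2) * derivative (derivative (jacobiMonic a b n)) +
      (C (b - a) - C (a + b + 2) * X) * derivative (jacobiMonic a b n) =
      -C ((n : ℝ) * (n + a + b + 1)) * jacobiMonic a b n := by
  have h := congrArg (fun g => g.comp (C (1 / 2 : ℝ) * (1 - X))) (jacobiHyp_ode a b ha n)
  simp only [add_comp, mul_comp, sub_comp, X_comp, one_comp, neg_comp, C_comp] at h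
  rw [jacobiMonic_eq_comp]
  simp only [derivative_mul, derivative_C, zero_mul, zero_add, derivative_comp, derivative_sub,
    derivative_one, derivative_X, derivative_zero]
  set g0 := (jacobiHyp a b n).comp (C (1 / 2 : ℝ) * (1 - X))
  set g1 := (derivative (jacobiHyp a b n)).comp (C (1 / 2 : ℝ) * (1 - X))
  set g2 := (derivative (derivative (jacobiHyp a b n))).comp (C (1 / 2 : ℝ) * (1 - X))
  set K := C (2 ^ n * risingFactorial (a + 1) n / risingFactorial ((n : ℝ) + a + b + 1) n)
  have hX : (C (1 / 2 : ℝ) : ℝ[X]) * 2 = 1 := by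
    rw [← C_ofNat, ← C_mul]; norm_num
  set H : ℝ[X] := C (1 / 2 : ℝ)
  simp only [C_add, C_sub, C_mul, C_1, C_ofNat] at h ⊢
  linear_combination K * h + (K * g2 * H * (1 - X) + K * g1 * (C a + 1)) * hX

/-- Differentiation shifts both parameters by one; this drives the induction that computes the
norms. -/
lemma derivative_jacobiMonic (a b : ℝ) (ha : -1 < a) (hb : -1 < b) (n : ℕ) :
    derivative (jacobiMonic a b (n + 1)) =
      C ((n : ℝ) + 1) * jacobiMonic (a + 1) (b + 1) n := by
  rw [jacobiMonic_eq_comp, jacobiMonic_eq_comp, derivative_mul, derivative_C, derivative_comp,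
    derivative_jacobiHyp a b ha, derivative_half_sub, mul_comp, C_comp]
  have e : 2 ^ (n + 1) * risingFactorial (a + 1) (n + 1) /
      risingFactorial (((n + 1 : ℕ) : ℝ) + a + b + 1) (n + 1) * (-((n : ℝ) + 1) *
      (n + a + b + 2) / (a + 1)) * (-(1 / 2)) = ((n : ℝ) + 1) *
      (2 ^ n * risingFactorial (a + 1 + 1) n /
        risingFactorial ((n : ℝ) + (a + 1) + (b + 1) + 1) n) := by
    have hn : (0 : ℝ) ≤ n := n.cast_nonneg
    have h2 : risingFactorial ((n : ℝ) + (a + 1) + (b + 1) + 1) n ≠ 0 :=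
      (risingFactorial_pos fun _ => by linarith).ne'
    have e2 : ((n + 1 : ℕ) : ℝ) + a + b + 1 + 1 = n + (a + 1) + (b + 1) + 1 := by push_cast; ring
    rw [risingFactorial_succ_left, risingFactorial_succ_left, e2]
    have h3 : a + 1 ≠ 0 := by linarith
    have h4 : ((n + 1 : ℕ) : ℝ) + a + b + 1 = n + a + b + 2 := by push_cast; ring
    rw [h4]
    by_cases h5 : (n : ℝ) + a + b + 2 = 0
    · exfalso; linarith
    field_simp
    ring
  set G := (jacobiHyp (a + 1) (b + 1) n).comp (C (1 / 2 : ℝ) * (1 - X))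
  rw [zero_mul, zero_add]
  calc _ = C (2 ^ (n + 1) * risingFactorial (a + 1) (n + 1) /
      risingFactorial (((n + 1 : ℕ) : ℝ) + a + b + 1) (n + 1) * (-((n : ℝ) + 1) *
      (n + a + b + 2) / (a + 1)) * (-(1 / 2))) * G := by
        rw [C_mul, C_mul, C_neg]; ring
    _ = _ := by rw [e, C_mul, mul_assoc]

lemma natDegree_jacobiMonic_le (a b : ℝ) (n : ℕ) : (jacobiMonic a b n).natDegree ≤ n := by
  refine (natDegree_C_mul_le _ _).trans (natDegree_sum_le_of_forall_le _ _ fun k hk => ?_)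
  refine (natDegree_C_mul_le _ _).trans (natDegree_pow_le.trans ?_)
  have : (C (1 / 2 : ℝ) * (1 - X)).natDegree ≤ 1 := by compute_degree
  have hk : k ≤ n := by simpa [Nat.lt_succ_iff] using hk
  nlinarith

lemma coeff_jacobiMonic_self (a b : ℝ) (ha : -1 < a) (hb : -1 < b) (n : ℕ) :
    (jacobiMonic a b n).coeff n = 1 := by
  have hT : (C (1 / 2 : ℝ) * (1 - X)).natDegree ≤ 1 := by compute_degree
  have hc : ((C (1 / 2 : ℝ) * (1 - X)) ^ n).coeff n = (-(1 / 2)) ^ n := by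
    have := coeff_pow_of_natDegree_le (m := n) hT
    rw [mul_one] at this
    rw [this]; simp [coeff_one, coeff_X]
  rw [jacobiMonic, coeff_C_mul, Finset.sum_range_succ, coeff_add, finsetSum_coeff,
    Finset.sum_eq_zero, coeff_C_mul, hc, zero_add, risingFactorial_neg_self]
  · have h1 : risingFactorial ((n : ℝ) + a + b + 1) n ≠ 0 :=
      (risingFactorial_pos fun h => by
        have : (1 : ℝ) ≤ n := by exact_mod_cast Nat.one_le_iff_ne_zero.2 h
        linarith).ne'
    have h2 : risingFactorial (a + 1) n ≠ 0 := (risingFactorial_pos fun _ => by linarith).ne'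
    have h3 : (n.factorial : ℝ) ≠ 0 := by exact_mod_cast n.factorial_ne_zero
    field_simp
    rw [← mul_pow, ← mul_pow]; norm_num
  · intro k hk
    rw [coeff_C_mul, coeff_eq_zero_of_natDegree_lt, mul_zero]
    have hk : k < n := by simpa using hk
    exact (natDegree_pow_le.trans (Nat.mul_le_mul_left k hT)).trans_lt (by omega)

end JacobiAlgebra

/-! ### Integration against the Jacobi weight and the Pearson identity. -/

section JacobiWeightAnalysis

open Polynomial

/-- The substitution u = (1+z)/2 reduces integrability and total mass to the beta integral. The
exponent d of 1+z becomes the exponent of u, so the parameters appear in reversed order. -/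
lemma jacobiWeight_eq_beta_integrand (c d : ℝ) {z : ℝ} (hz : z ∈ Ioo (-1 : ℝ) 1) :
    ((jacobiWeight c d z : ℝ) : ℂ) = (((2 : ℝ) ^ (c + d) : ℝ) : ℂ) *
      ((((1 / 2 * (z + 1) : ℝ) : ℂ) ^ (((d + 1 : ℝ) : ℂ) - 1)) *
        (1 - ((1 / 2 * (z + 1) : ℝ) : ℂ)) ^ (((c + 1 : ℝ) : ℂ) - 1)) := by
  have h1 : (0 : ℝ) < 1 - z := by linarith [hz.2]
  have h2 : (0 : ℝ) < 1 + z := by linarith [hz.1]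
  have e1 : ((d + 1 : ℝ) : ℂ) - 1 = (d : ℂ) := by push_cast; ring
  have e2 : ((c + 1 : ℝ) : ℂ) - 1 = (c : ℂ) := by push_cast; ring
  have e3 : 1 - ((1 / 2 * (z + 1) : ℝ) : ℂ) = ((1 / 2 * (1 - z) : ℝ) : ℂ) := by push_cast; ring
  rw [e1, e2, e3, ← Complex.ofReal_cpow (by linarith), ← Complex.ofReal_cpow (by linarith),
    ← Complex.ofReal_mul, ← Complex.ofReal_mul, Complex.ofReal_inj, jacobiWeight]
  rw [Real.mul_rpow (by norm_num) (by linarith), Real.mul_rpow (by norm_num) h1.le,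
    Real.rpow_add two_pos, one_div, Real.inv_rpow two_pos.le, Real.inv_rpow two_pos.le,
    add_comm z 1]
  have h3 := (Real.rpow_pos_of_pos two_pos c).ne'
  have h4 := (Real.rpow_pos_of_pos two_pos d).ne'
  field_simp

lemma integrableOn_jacobiWeight {c d : ℝ} (hc : -1 < c) (hd : -1 < d) :
    IntegrableOn (fun z => ((jacobiWeight c d z : ℝ) : ℂ)) (Ioo (-1) 1) := by
  have h := Complex.betaIntegral_convergent (u := ((d + 1 : ℝ) : ℂ)) (v := ((c + 1 : ℝ) : ℂ))
    (by simp; linarith) (by simp; linarith)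
  have h1 := ((h.comp_mul_left (c := 1 / 2)).comp_add_right 1).const_mul
    (((2 : ℝ) ^ (c + d) : ℝ) : ℂ)
  norm_num at h1
  rw [intervalIntegrable_iff_integrableOn_Ioo_of_le (by norm_num)] at h1
  refine h1.congr_fun (fun z hz => ?_) measurableSet_Ioo
  simp only [jacobiWeight_eq_beta_integrand c d hz]
  push_cast
  norm_num

lemma integral_jacobiWeight {c d : ℝ} (hc : -1 < c) (hd : -1 < d) :
    ∫ z in Ioo (-1 : ℝ) 1, ((jacobiWeight c d z : ℝ) : ℂ) =
      (((2 : ℝ) ^ (c + d + 1) * (Real.Gamma (c + 1) * Real.Gamma (d + 1)) /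
        Real.Gamma (c + d + 2) : ℝ) : ℂ) := by
  rw [setIntegral_congr_fun measurableSet_Ioo
    (fun z hz => jacobiWeight_eq_beta_integrand c d hz), integral_const_mul,
    ← integral_Ioc_eq_integral_Ioo, ← intervalIntegral.integral_of_le (by norm_num)]
  have h := intervalIntegral.integral_comp_mul_add (a := -1) (b := 1)
    (fun x : ℝ => (x : ℂ) ^ (((d + 1 : ℝ) : ℂ) - 1) * (1 - (x : ℂ)) ^ (((c + 1 : ℝ) : ℂ) - 1))
    (c := 1 / 2) (by norm_num) (1 / 2)
  have e : ∀ z : ℝ, 1 / 2 * (z + 1) = 1 / 2 * z + 1 / 2 := fun z => by ring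
  simp only [e]
  rw [h]
  have h0 : (1 / 2 * -1 + 1 / 2 : ℝ) = 0 := by norm_num
  have h1 : (1 / 2 * 1 + 1 / 2 : ℝ) = 1 := by norm_num
  rw [h0, h1]
  change _ * (_ • Complex.betaIntegral ((d + 1 : ℝ) : ℂ) ((c + 1 : ℝ) : ℂ)) = _
  rw [Complex.betaIntegral_eq_Gamma_mul_div _ _ (by simp; linarith) (by simp; linarith),
    ← Complex.ofReal_add, Complex.Gamma_ofReal, Complex.Gamma_ofReal, Complex.Gamma_ofReal,
    Complex.real_smul]
  norm_cast
  rw [Real.rpow_add_one two_ne_zero]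
  have e3 : d + 1 + (c + 1) = c + d + 2 := by ring
  rw [e3]
  field_simp

lemma integrableOn_polynomial_mul_jacobiWeight {c d : ℝ} (hc : -1 < c) (hd : -1 < d)
    (f : ℂ[X]) :
    IntegrableOn (fun z : ℝ => f.eval (z : ℂ) * ((jacobiWeight c d z : ℝ) : ℂ))
      (Ioo (-1) 1) :=
  (integrableOn_jacobiWeight hc hd).continuousOn_mul_of_subset
    (K := Icc (-1) 1) (by fun_prop) isCompact_Icc measurableSet_Ioo Ioo_subset_Icc_self

/-- The linear functional `f ↦ ∫ f(z) (1 - z)^c (1 + z)^d dz` over `(-1, 1)`. -/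
noncomputable def jacobiIntegral {c d : ℝ} (hc : -1 < c) (hd : -1 < d) : ℂ[X] →ₗ[ℂ] ℂ where
  toFun f := ∫ z in Ioo (-1 : ℝ) 1, f.eval (z : ℂ) * ((jacobiWeight c d z : ℝ) : ℂ)
  map_add' f g := by
    rw [← integral_add (integrableOn_polynomial_mul_jacobiWeight hc hd f)
      (integrableOn_polynomial_mul_jacobiWeight hc hd g)]
    simp [add_mul]
  map_smul' r f := by
    rw [RingHom.id_apply, smul_eq_mul, ← integral_const_mul]
    simp [mul_assoc]

lemma jacobiIntegral_apply {c d : ℝ} (hc : -1 < c) (hd : -1 < d) (f : ℂ[X]) :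
    jacobiIntegral hc hd f =
      ∫ z in Ioo (-1 : ℝ) 1, f.eval (z : ℂ) * ((jacobiWeight c d z : ℝ) : ℂ) := rfl

lemma jacobiWeight_add_one (c d : ℝ) {z : ℝ} (hz : z ∈ Ioo (-1 : ℝ) 1) :
    jacobiWeight (c + 1) (d + 1) z = (1 - z ^ 2) * jacobiWeight c d z := by
  have h1 : (1 : ℝ) - z ≠ 0 := by linarith [hz.2]
  have h2 : (1 : ℝ) + z ≠ 0 := by linarith [hz.1]
  rw [jacobiWeight, jacobiWeight, Real.rpow_add_one h1, Real.rpow_add_one h2]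
  ring

/-- The polynomial `((1 - z)^(c+1) (1 + z)^(d+1) f)' / ((1 - z)^c (1 + z)^d)`. -/
noncomputable def pearson (c d : ℝ) (f : ℂ[X]) : ℂ[X] :=
  (1 - X ^ 2) * derivative f + (C ((d - c : ℝ) : ℂ) - C ((c + d + 2 : ℝ) : ℂ) * X) * f

lemma hasDerivAt_jacobiWeight (c d : ℝ) {z : ℝ} (hz : z ∈ Ioo (-1 : ℝ) 1) :
    HasDerivAt (jacobiWeight (c + 1) (d + 1))
      ((d - c - (c + d + 2) * z) * jacobiWeight c d z) z := by
  have h1 : (1 : ℝ) - z ≠ 0 := by linarith [hz.2]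
  have h2 : (1 : ℝ) + z ≠ 0 := by linarith [hz.1]
  have H := (((hasDerivAt_id z).const_sub 1).rpow_const (p := c + 1) (Or.inl h1)).mul
    (((hasDerivAt_id z).const_add 1).rpow_const (p := d + 1) (Or.inl h2))
  refine H.congr_deriv ?_
  simp only [id, add_sub_cancel_right, Real.rpow_add_one h1, Real.rpow_add_one h2, jacobiWeight]
  ring

lemma hasDerivAt_mul_jacobiWeight (c d : ℝ) (f : ℂ[X]) {z : ℝ} (hz : z ∈ Ioo (-1 : ℝ) 1) :
    HasDerivAt (fun z : ℝ => f.eval (z : ℂ) * ((jacobiWeight (c + 1) (d + 1) z : ℝ) : ℂ))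
      ((pearson c d f).eval (z : ℂ) * ((jacobiWeight c d z : ℝ) : ℂ)) z := by
  have H := ((f.hasDerivAt (z : ℂ)).comp_ofReal).mul (hasDerivAt_jacobiWeight c d hz).ofReal_comp
  refine H.congr_deriv ?_
  rw [jacobiWeight_add_one c d hz]
  simp [pearson]
  ring

lemma continuous_jacobiWeight {c d : ℝ} (hc : 0 ≤ c) (hd : 0 ≤ d) :
    Continuous (jacobiWeight c d) := by
  unfold jacobiWeight
  exact (Continuous.rpow_const (by fun_prop) fun _ => Or.inr hc).mul
    (Continuous.rpow_const (by fun_prop) fun _ => Or.inr hd)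

/-- The primitive carries the exponents c+1, d+1 > 0, so it is continuous up to ±1 even where the
integrand blows up; integrability of the latter suffices. General endpoints are needed to cut the
sign kernel at an interior point. -/
lemma intervalIntegral_pearson {c d : ℝ} (hc : -1 < c) (hd : -1 < d) (f : ℂ[X]) {s t : ℝ}
    (hs : -1 ≤ s) (hst : s ≤ t) (ht : t ≤ 1) :
    ∫ z in s..t, (pearson c d f).eval (z : ℂ) * ((jacobiWeight c d z : ℝ) : ℂ) =
      f.eval (t : ℂ) * ((jacobiWeight (c + 1) (d + 1) t : ℝ) : ℂ) -
        f.eval (s : ℂ) * ((jacobiWeight (c + 1) (d + 1) s : ℝ) : ℂ) := by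
  have hcont := continuous_jacobiWeight (c := c + 1) (d := d + 1) (by linarith) (by linarith)
  refine intervalIntegral.integral_eq_sub_of_hasDerivAt_of_le hst ?_ (fun z hz =>
    hasDerivAt_mul_jacobiWeight c d f ⟨by linarith [hz.1], by linarith [hz.2]⟩) ?_
  · exact Continuous.continuousOn (by fun_prop)
  · rw [intervalIntegrable_iff_integrableOn_Ioo_of_le hst]
    exact (integrableOn_polynomial_mul_jacobiWeight hc hd _).mono_set (Ioo_subset_Ioo hs ht)

lemma jacobiWeight_one {c : ℝ} (hc : c ≠ 0) (d : ℝ) : jacobiWeight c d 1 = 0 := by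
  simp [jacobiWeight, Real.zero_rpow hc]

lemma jacobiWeight_neg_one {d : ℝ} (hd : d ≠ 0) (c : ℝ) : jacobiWeight c d (-1) = 0 := by
  simp [jacobiWeight, Real.zero_rpow hd]

lemma jacobiIntegral_pearson {c d : ℝ} (hc : -1 < c) (hd : -1 < d) (f : ℂ[X]) :
    jacobiIntegral hc hd (pearson c d f) = 0 := by
  rw [jacobiIntegral_apply, ← integral_Ioc_eq_integral_Ioo,
    ← intervalIntegral.integral_of_le (by norm_num),
    intervalIntegral_pearson hc hd f le_rfl (by norm_num) le_rfl,
    jacobiWeight_one (by linarith), jacobiWeight_neg_one (by linarith)]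
  simp

lemma jacobiIntegral_add_one {c d : ℝ} (hc : -1 < c) (hd : -1 < d) (hc' : -1 < c + 1)
    (hd' : -1 < d + 1) (f : ℂ[X]) :
    jacobiIntegral hc' hd' f = jacobiIntegral hc hd ((1 - X ^ 2) * f) := by
  rw [jacobiIntegral_apply, jacobiIntegral_apply]
  refine setIntegral_congr_fun measurableSet_Ioo fun z hz => ?_
  simp only [jacobiWeight_add_one c d hz]
  simp
  ring

lemma jacobiIntegral_one {c d : ℝ} (hc : -1 < c) (hd : -1 < d) :
    jacobiIntegral hc hd 1 = (((2 : ℝ) ^ (c + d + 1) * (Real.Gamma (c + 1) * Real.Gamma (d + 1)) /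
        Real.Gamma (c + d + 2) : ℝ) : ℂ) := by
  rw [jacobiIntegral_apply, ← integral_jacobiWeight hc hd]
  simp

end JacobiWeightAnalysis

/-! ### Both skew forms expressed through one first-order operator. -/

section SkewForms

open Polynomial

/-- The operator `f ↦ (1 - X²) f' + ½ ((b - a) - (a + b + 2) X) f`. -/
noncomputable def jacobiSkewOp (a b : ℝ) (f : ℂ[X]) : ℂ[X] :=
  pearson ((a - 1) / 2) ((b - 1) / 2) f

lemma jacobiSkewOp_eq (a b : ℝ) (f : ℂ[X]) :
    jacobiSkewOp a b f = (1 - X ^ 2) * derivative f +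
      C (1 / 2) * ((C ((b - a : ℝ) : ℂ) - C ((a + b + 2 : ℝ) : ℂ) * X) * f) := by
  have e1 : (((b - 1) / 2 - (a - 1) / 2 : ℝ) : ℂ) = 1 / 2 * ((b - a : ℝ) : ℂ) := by
    push_cast; ring
  have e2 : (((a - 1) / 2 + (b - 1) / 2 + 2 : ℝ) : ℂ) = 1 / 2 * ((a + b + 2 : ℝ) : ℂ) := by
    push_cast; ring
  rw [jacobiSkewOp, pearson, e1, e2, C_mul, C_mul]
  ring

lemma C_half_mul_two : (C (1 / 2 : ℂ) : ℂ[X]) * 2 = 1 := by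
  rw [← C_ofNat, ← C_mul]; norm_num

/-- The Pearson operator of w applied to fg is f·Dg + Df·g, because D takes exactly half of the
zeroth-order term; its integral has no boundary contribution. -/
lemma jacobiIntegral_mul_jacobiSkewOp {a b : ℝ} (ha : -1 < a) (hb : -1 < b) (f g : ℂ[X]) :
    jacobiIntegral ha hb (f * jacobiSkewOp a b g) =
      -jacobiIntegral ha hb (jacobiSkewOp a b f * g) := by
  have h := jacobiIntegral_pearson ha hb (f * g)
  have e : pearson a b (f * g) = f * jacobiSkewOp a b g + jacobiSkewOp a b f * g := by
    rw [pearson, jacobiSkewOp_eq, jacobiSkewOp_eq, derivative_mul]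
    linear_combination (-(C ((b - a : ℝ) : ℂ) - C ((a + b + 2 : ℝ) : ℂ) * X) * f * g) *
      C_half_mul_two
  rw [e, map_add] at h
  exact eq_neg_of_add_eq_zero_left h

/-- The zeroth-order terms of D cancel in f·Dg - Df·g, leaving (1-z²)(fg' - f'g). Skew-adjointness
then makes the two halves equal. -/
lemma skewFour_eq {a b : ℝ} (ha : -1 < a) (hb : -1 < b) (f g : ℂ[X]) :
    skewFour a b f g = jacobiIntegral ha hb (f * jacobiSkewOp a b g) := by
  have e : skewFour a b f g =
      1 / 2 * jacobiIntegral (by linarith : -1 < a + 1) (by linarith : -1 < b + 1)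
        (f * derivative g - derivative f * g) := by
    rw [skewFour, jacobiIntegral_apply]; simp
  have e2 : (1 - X ^ 2) * (f * derivative g - derivative f * g) =
      f * jacobiSkewOp a b g - jacobiSkewOp a b f * g := by
    rw [jacobiSkewOp_eq, jacobiSkewOp_eq]; ring
  rw [e, jacobiIntegral_add_one ha hb, e2, map_sub, jacobiIntegral_mul_jacobiSkewOp]
  ring

lemma norm_real_sign_le (x : ℝ) : ‖((Real.sign x : ℝ) : ℂ)‖ ≤ 1 := by
  rcases Real.sign_apply_eq x with h | h | h <;> simp [h]

lemma measurable_real_sign : Measurable Real.sign := by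
  unfold Real.sign
  exact Measurable.ite measurableSet_Iio measurable_const
    (Measurable.ite measurableSet_Ioi measurable_const measurable_const)

/-- The integrand of `2 ⟨f, g⟩₁` as a function on the plane. -/
noncomputable def skewOneIntegrand (a b : ℝ) (f g : ℂ[X]) (p : ℝ × ℝ) : ℂ :=
  f.eval (p.1 : ℂ) * g.eval (p.2 : ℂ) *
      ((Real.sign (p.2 - p.1) * jacobiWeight ((a - 1) / 2) ((b - 1) / 2) p.1 *
        jacobiWeight ((a - 1) / 2) ((b - 1) / 2) p.2 : ℝ) : ℂ)

lemma integrable_skewOneIntegrand {a b : ℝ} (ha : -1 < a) (hb : -1 < b) (f g : ℂ[X]) :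
    Integrable (skewOneIntegrand a b f g)
      ((volume.restrict (Ioo (-1 : ℝ) 1)).prod (volume.restrict (Ioo (-1 : ℝ) 1))) := by
  have h (f : ℂ[X]) := integrableOn_polynomial_mul_jacobiWeight (c := (a - 1) / 2)
    (d := (b - 1) / 2) (by linarith) (by linarith) f
  have h2 := ((h f).mul_prod (h g)).bdd_mul (c := 1)
    (f := fun p : ℝ × ℝ => ((Real.sign (p.2 - p.1) : ℝ) : ℂ))
    (Complex.measurable_ofReal.comp
      (measurable_real_sign.comp (measurable_snd.sub measurable_fst))).aestronglyMeasurable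
    (Filter.Eventually.of_forall fun p => norm_real_sign_le _)
  refine h2.congr (Filter.Eventually.of_forall fun p => ?_)
  simp only [skewOneIntegrand]
  push_cast
  ring

/-- Fubini: on the product measure, bilinearity and skew symmetry become statements about the
integrand. -/
lemma skewOne_eq_integral_prod {a b : ℝ} (ha : -1 < a) (hb : -1 < b) (f g : ℂ[X]) :
    skewOne a b f g = 1 / 2 * ∫ p, skewOneIntegrand a b f g p
      ∂((volume.restrict (Ioo (-1 : ℝ) 1)).prod (volume.restrict (Ioo (-1 : ℝ) 1))) := by
  rw [integral_prod _ (integrable_skewOneIntegrand ha hb f g)]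
  rfl

lemma skewOne_swap {a b : ℝ} (ha : -1 < a) (hb : -1 < b) (f g : ℂ[X]) :
    skewOne a b f g = -skewOne a b g f := by
  rw [skewOne_eq_integral_prod ha hb, skewOne_eq_integral_prod ha hb, ← integral_prod_swap,
    ← mul_neg, ← integral_neg]
  congr 2
  ext p
  simp only [skewOneIntegrand, Prod.fst_swap, Prod.snd_swap]
  rw [← neg_sub p.2 p.1, Real.sign_neg]
  push_cast
  ring

/-- The form `⟨f, g⟩₁` as a bilinear map. -/
noncomputable def skewOneBilin {a b : ℝ} (ha : -1 < a) (hb : -1 < b) :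
    ℂ[X] →ₗ[ℂ] ℂ[X] →ₗ[ℂ] ℂ :=
  LinearMap.mk₂ ℂ (skewOne a b)
    (fun f f' g => by
      simp only [skewOne_eq_integral_prod ha hb]
      rw [← mul_add, ← integral_add (integrable_skewOneIntegrand ha hb f g)
        (integrable_skewOneIntegrand ha hb f' g)]
      simp [skewOneIntegrand, add_mul])
    (fun r f g => by
      simp only [skewOne_eq_integral_prod ha hb]
      rw [smul_eq_mul, mul_left_comm r, ← integral_const_mul r]
      congr 2; ext p; simp only [skewOneIntegrand, eval_smul, smul_eq_mul]; ring)
    (fun f g g' => by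
      simp only [skewOne_eq_integral_prod ha hb]
      rw [← mul_add, ← integral_add (integrable_skewOneIntegrand ha hb f g)
        (integrable_skewOneIntegrand ha hb f g')]
      simp [skewOneIntegrand, add_mul, mul_add])
    (fun r f g => by
      simp only [skewOne_eq_integral_prod ha hb]
      rw [smul_eq_mul, mul_left_comm r, ← integral_const_mul r]
      congr 2; ext p; simp only [skewOneIntegrand, eval_smul, smul_eq_mul]; ring)

@[simp] lemma skewOneBilin_apply {a b : ℝ} (ha : -1 < a) (hb : -1 < b) (f g : ℂ[X]) :
    skewOneBilin ha hb f g = skewOne a b f g := rfl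

/-- Half the sign kernel has derivative equal to a delta function at y. Concretely, the primitive
vanishes at ±1 and both pieces of the integral contribute minus its value at y. -/
lemma integral_sign_pearson {c d : ℝ} (hc : -1 < c) (hd : -1 < d) (f : ℂ[X]) {y : ℝ}
    (hy : y ∈ Ioo (-1 : ℝ) 1) :
    ∫ z in Ioo (-1 : ℝ) 1, ((Real.sign (z - y) : ℝ) : ℂ) *
      ((pearson c d f).eval (z : ℂ) * ((jacobiWeight c d z : ℝ) : ℂ)) =
      -2 * (f.eval (y : ℂ) * ((jacobiWeight (c + 1) (d + 1) y : ℝ) : ℂ)) := by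
  set F : ℝ → ℂ := fun z => (pearson c d f).eval (z : ℂ) * ((jacobiWeight c d z : ℝ) : ℂ)
  have hF : IntegrableOn F (Ioo (-1) 1) := integrableOn_polynomial_mul_jacobiWeight hc hd _
  have hG : IntegrableOn (fun z : ℝ => ((Real.sign (z - y) : ℝ) : ℂ) * F z) (Ioo (-1) 1) :=
    hF.bdd_mul (c := 1) (Complex.measurable_ofReal.comp
      (measurable_real_sign.comp (measurable_id.sub_const y))).aestronglyMeasurable
      (Filter.Eventually.of_forall fun p => norm_real_sign_le _)
  have h1 : ∫ z in (-1)..y, ((Real.sign (z - y) : ℝ) : ℂ) * F z = -∫ z in (-1)..y, F z := by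
    rw [intervalIntegral.integral_of_le hy.1.le, intervalIntegral.integral_of_le hy.1.le,
      integral_Ioc_eq_integral_Ioo, integral_Ioc_eq_integral_Ioo, ← integral_neg]
    refine setIntegral_congr_fun measurableSet_Ioo fun z hz => ?_
    simp [Real.sign_of_neg (sub_neg.2 hz.2)]
  have h2 : ∫ z in y..1, ((Real.sign (z - y) : ℝ) : ℂ) * F z = ∫ z in y..1, F z := by
    rw [intervalIntegral.integral_of_le hy.2.le, intervalIntegral.integral_of_le hy.2.le,
      integral_Ioc_eq_integral_Ioo, integral_Ioc_eq_integral_Ioo]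
    refine setIntegral_congr_fun measurableSet_Ioo fun z hz => ?_
    simp [Real.sign_of_pos (sub_pos.2 hz.1)]
  rw [← integral_Ioc_eq_integral_Ioo, ← intervalIntegral.integral_of_le (by norm_num),
    ← intervalIntegral.integral_add_adjacent_intervals (b := y), h1, h2,
    intervalIntegral_pearson hc hd f le_rfl hy.1.le hy.2.le,
    intervalIntegral_pearson hc hd f hy.1.le hy.2.le le_rfl,
    jacobiWeight_one (by linarith), jacobiWeight_neg_one (by linarith)]
  · push_cast; ring
  · rw [intervalIntegrable_iff_integrableOn_Ioo_of_le hy.1.le]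
    exact hG.mono_set (Ioo_subset_Ioo le_rfl hy.2.le)
  · rw [intervalIntegrable_iff_integrableOn_Ioo_of_le hy.2.le]
    exact hG.mono_set (Ioo_subset_Ioo hy.1.le le_rfl)

lemma skewOne_jacobiSkewOp {a b : ℝ} (ha : -1 < a) (hb : -1 < b) (f g : ℂ[X]) :
    skewOne a b f (jacobiSkewOp a b g) = -jacobiIntegral ha hb (f * g) := by
  rw [skewOne, jacobiIntegral_apply, ← integral_const_mul, ← integral_neg]
  refine setIntegral_congr_fun measurableSet_Ioo fun y hy => ?_
  have h := integral_sign_pearson (c := (a - 1) / 2) (d := (b - 1) / 2) (by linarith)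
    (by linarith) g hy
  -- w₁ · (1-y²)w₁ = w, since (a-1)/2 + (a+1)/2 = a and likewise for b.
  have hw : jacobiWeight ((a - 1) / 2) ((b - 1) / 2) y *
      jacobiWeight ((a - 1) / 2 + 1) ((b - 1) / 2 + 1) y = jacobiWeight a b y := by
    have h1 : (0 : ℝ) < 1 - y := by linarith [hy.2]
    have h2 : (0 : ℝ) < 1 + y := by linarith [hy.1]
    rw [jacobiWeight, jacobiWeight, jacobiWeight, mul_mul_mul_comm, ← Real.rpow_add h1,
      ← Real.rpow_add h2]
    congr 2 <;> ring
  have e : ∀ z : ℝ, f.eval (y : ℂ) * (jacobiSkewOp a b g).eval (z : ℂ) *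
      ((Real.sign (z - y) * jacobiWeight ((a - 1) / 2) ((b - 1) / 2) y *
        jacobiWeight ((a - 1) / 2) ((b - 1) / 2) z : ℝ) : ℂ) =
      (f.eval (y : ℂ) * ((jacobiWeight ((a - 1) / 2) ((b - 1) / 2) y : ℝ) : ℂ)) *
      (((Real.sign (z - y) : ℝ) : ℂ) * ((pearson ((a - 1) / 2) ((b - 1) / 2) g).eval (z : ℂ) *
        ((jacobiWeight ((a - 1) / 2) ((b - 1) / 2) z : ℝ) : ℂ))) := by
    intro z
    rw [jacobiSkewOp]
    push_cast
    ring
  simp only [e, integral_const_mul, h, ← hw, eval_mul]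
  push_cast
  ring

end SkewForms

/-! ### Monic bases of polynomials with one element in each degree. -/

section PolynomialBasis

open Polynomial

variable {p : ℕ → ℂ[X]}

lemma degree_sub_C_mul_lt (hm : ∀ n, (p n).Monic) (hd : ∀ n, (p n).natDegree = n) {n : ℕ}
    {f : ℂ[X]} (hf : f.degree < (n + 1 : ℕ)) : (f - C (f.coeff n) * p n).degree < n := by
  rw [degree_lt_iff_coeff_zero] at hf ⊢
  intro k hk
  have hc : (p n).coeff n = 1 := by have := hm n; rwa [Monic, leadingCoeff, hd] at this
  rcases hk.eq_or_lt with rfl | hk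
  · simp [hc]
  · rw [coeff_sub, coeff_C_mul, hf k hk, coeff_eq_zero_of_natDegree_lt (p := p n) (by rwa [hd])]
    simp

lemma exists_eq_sum_of_degree_lt (hm : ∀ n, (p n).Monic) (hd : ∀ n, (p n).natDegree = n)
    (n : ℕ) : ∀ f : ℂ[X], f.degree < n → ∃ c : ℕ → ℂ, f = ∑ i ∈ Finset.range n, c i • p i := by
  induction n with
  | zero =>
    intro f hf
    exact ⟨0, by simpa using hf⟩
  | succ n ih =>
    intro f hf
    obtain ⟨c, hc⟩ := ih _ (degree_sub_C_mul_lt hm hd hf)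
    refine ⟨Function.update c n (f.coeff n), ?_⟩
    rw [Finset.sum_range_succ, Function.update_self, ← sub_eq_iff_eq_add, smul_eq_C_mul, hc]
    refine Finset.sum_congr rfl fun i hi => ?_
    rw [Function.update_of_ne (Finset.mem_range.1 hi).ne]

lemma linearMap_eq_zero_of_degree_lt (hm : ∀ n, (p n).Monic) (hd : ∀ n, (p n).natDegree = n)
    {n : ℕ} (φ : ℂ[X] →ₗ[ℂ] ℂ) (h : ∀ i < n, φ (p i) = 0) {f : ℂ[X]} (hf : f.degree < n) :
    φ f = 0 := by
  obtain ⟨c, rfl⟩ := exists_eq_sum_of_degree_lt hm hd n f hf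
  rw [map_sum]
  exact Finset.sum_eq_zero fun i hi => by rw [map_smul, h i (Finset.mem_range.1 hi), smul_zero]

/-- Each basis element p_i has a partner p_{σ i} against which only p_i pairs nontrivially, so
testing f against the partner isolates the i-th coefficient. Used with σ = id for the Jacobi pairing
and with σ swapping 2k and 2k+1 for the skew form. -/
lemma eq_zero_of_bilin_eq_zero (hm : ∀ n, (p n).Monic) (hd : ∀ n, (p n).natDegree = n)
    {n : ℕ} (B : ℂ[X] →ₗ[ℂ] ℂ[X] →ₗ[ℂ] ℂ) (σ : ℕ → ℕ) (hσ : ∀ i < n, σ i < n)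
    (h1 : ∀ i < n, B (p i) (p (σ i)) ≠ 0)
    (h0 : ∀ i < n, ∀ j < n, j ≠ i → B (p j) (p (σ i)) = 0) {f : ℂ[X]} (hf : f.degree < n)
    (h : ∀ j < n, B f (p j) = 0) : f = 0 := by
  obtain ⟨c, rfl⟩ := exists_eq_sum_of_degree_lt hm hd n f hf
  refine Finset.sum_eq_zero fun i hi => ?_
  have hi' := Finset.mem_range.1 hi
  have := h (σ i) (hσ i hi')
  rw [map_sum, LinearMap.sum_apply, Finset.sum_eq_single_of_mem i hi, map_smul,
    LinearMap.smul_apply, smul_eq_mul, mul_eq_zero, or_iff_left (h1 i hi')] at this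
  · rw [this, zero_smul]
  · intro j hj hji
    rw [map_smul, LinearMap.smul_apply, h0 i hi' j (Finset.mem_range.1 hj) hji, smul_zero]

end PolynomialBasis

/-! ### Orthogonality and norms of the Jacobi polynomials; the action of D on them. -/

section JacobiOrthogonality

open Polynomial

lemma natDegree_jacobiMonic {a b : ℝ} (ha : -1 < a) (hb : -1 < b) (n : ℕ) :
    (jacobiMonic a b n).natDegree = n :=
  natDegree_eq_of_le_of_coeff_ne_zero (natDegree_jacobiMonic_le a b n)
    (by rw [coeff_jacobiMonic_self a b ha hb]; exact one_ne_zero)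

lemma monic_jacobiPoly {a b : ℝ} (ha : -1 < a) (hb : -1 < b) (n : ℕ) :
    (jacobiPoly a b n).Monic := by
  refine Monic.map _ ?_
  rw [Monic, leadingCoeff, natDegree_jacobiMonic ha hb, coeff_jacobiMonic_self a b ha hb]

lemma natDegree_jacobiPoly {a b : ℝ} (ha : -1 < a) (hb : -1 < b) (n : ℕ) :
    (jacobiPoly a b n).natDegree = n := by
  rw [jacobiPoly, natDegree_map, natDegree_jacobiMonic ha hb]

lemma coeff_jacobiPoly_self {a b : ℝ} (ha : -1 < a) (hb : -1 < b) (n : ℕ) :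
    (jacobiPoly a b n).coeff n = 1 := by
  rw [jacobiPoly, coeff_map, coeff_jacobiMonic_self a b ha hb, map_one]

lemma jacobiPoly_zero (a b : ℝ) : jacobiPoly a b 0 = 1 := by
  simp [jacobiPoly, jacobiMonic]

lemma pearson_derivative_jacobiPoly {a : ℝ} (ha : -1 < a) (b : ℝ) (n : ℕ) :
    pearson a b (derivative (jacobiPoly a b n)) =
      -C (((n : ℝ) * (n + a + b + 1) : ℝ) : ℂ) * jacobiPoly a b n := by
  have h := congrArg (Polynomial.map (algebraMap ℝ ℂ)) (jacobiMonic_ode a b ha n)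
  simpa [pearson, jacobiPoly, derivative_map] using h

lemma derivative_jacobiPoly {a b : ℝ} (ha : -1 < a) (hb : -1 < b) (n : ℕ) :
    derivative (jacobiPoly a b (n + 1)) =
      C ((n : ℂ) + 1) * jacobiPoly (a + 1) (b + 1) n := by
  rw [jacobiPoly, derivative_map, derivative_jacobiMonic a b ha hb, jacobiPoly]
  simp

lemma jacobiIntegral_pearson_derivative_mul {a b : ℝ} (ha : -1 < a) (hb : -1 < b) (f g : ℂ[X]) :
    jacobiIntegral ha hb (pearson a b (derivative f) * g) =
      -jacobiIntegral ha hb ((1 - X ^ 2) * (derivative f * derivative g)) := by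
  have h := jacobiIntegral_pearson ha hb (derivative f * g)
  have e : pearson a b (derivative f * g) = pearson a b (derivative f) * g +
      (1 - X ^ 2) * (derivative f * derivative g) := by
    rw [pearson, pearson, derivative_mul]; ring
  rw [e, map_add] at h
  exact eq_neg_of_add_eq_zero_left h

/-- The right-hand side is the Dirichlet form, symmetric in the two polynomials. Exchanging them
gives orthogonality; taking g = p_n gives the recursion for the norms. -/
lemma jacobi_eigenvalue_mul_integral {a b : ℝ} (ha : -1 < a) (hb : -1 < b) (n : ℕ) (g : ℂ[X]) :
    (((n : ℝ) * (n + a + b + 1) : ℝ) : ℂ) * jacobiIntegral ha hb (jacobiPoly a b n * g) =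
      jacobiIntegral ha hb ((1 - X ^ 2) * (derivative (jacobiPoly a b n) * derivative g)) := by
  have h := jacobiIntegral_pearson_derivative_mul ha hb (jacobiPoly a b n) g
  rw [pearson_derivative_jacobiPoly ha, neg_mul, neg_mul, mul_assoc, map_neg, neg_inj,
    ← smul_eq_C_mul, map_smul, smul_eq_mul] at h
  exact h

lemma jacobiIntegral_mul_of_ne {a b : ℝ} (ha : -1 < a) (hb : -1 < b) {m n : ℕ} (hmn : m ≠ n) :
    jacobiIntegral ha hb (jacobiPoly a b m * jacobiPoly a b n) = 0 := by
  wlog h : m < n generalizing m n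
  · rw [mul_comm]
    exact this hmn.symm (by omega)
  have h1 := jacobi_eigenvalue_mul_integral ha hb m (jacobiPoly a b n)
  have h2 := jacobi_eigenvalue_mul_integral ha hb n (jacobiPoly a b m)
  rw [mul_comm (derivative _), mul_comm (jacobiPoly a b n), ← h1, ← sub_eq_zero, ← sub_mul,
    mul_eq_zero] at h2
  refine h2.resolve_left ?_
  rw [← Complex.ofReal_sub]
  refine Complex.ofReal_ne_zero.2 ?_
  have h3 : (m : ℝ) + 1 ≤ n := by exact_mod_cast h
  have h4 : (0 : ℝ) ≤ m := m.cast_nonneg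
  -- The eigenvalues differ: n + m ≥ 1 and a + b > -2 make the second factor positive.
  have h5 : (n : ℝ) * (n + a + b + 1) - m * (m + a + b + 1) =
    (n - m) * (n + m + a + b + 1) := by ring
  rw [h5]
  exact mul_ne_zero (by linarith) (by linarith)

/-- The squared norm of the monic Jacobi polynomial of degree `n`. -/
noncomputable def jacobiSqNorm (a b : ℝ) (n : ℕ) : ℝ :=
  2 ^ (a + b + 2 * n + 1) * ((n.factorial : ℝ) * Real.Gamma (a + n + 1) * Real.Gamma (b + n + 1)) /
    (risingFactorial (n + a + b + 1) n * Real.Gamma (2 * n + a + b + 2))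

/-- Induction on the degree with a and b varying: the Dirichlet form of p_{n+1} is (n+1)² times the
squared norm of p_n for the weight with parameters a+1, b+1. The base case is the beta integral. -/
lemma jacobiIntegral_mul_self (n : ℕ) : ∀ {a b : ℝ} (ha : -1 < a) (hb : -1 < b),
    jacobiIntegral ha hb (jacobiPoly a b n * jacobiPoly a b n) = (jacobiSqNorm a b n : ℂ) := by
  induction n with
  | zero =>
    intro a b ha hb
    rw [jacobiPoly_zero, mul_one, jacobiIntegral_one, jacobiSqNorm]
    simp
  | succ n ih =>
    intro a b ha hb
    have ha' : -1 < a + 1 := by linarith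
    have hb' : -1 < b + 1 := by linarith
    have hn : (0 : ℝ) ≤ n := n.cast_nonneg
    have h := jacobi_eigenvalue_mul_integral ha hb (n + 1) (jacobiPoly a b (n + 1))
    rw [← jacobiIntegral_add_one ha hb ha' hb', derivative_jacobiPoly ha hb, mul_mul_mul_comm,
      ← C_mul, ← smul_eq_C_mul, map_smul, ih, smul_eq_mul] at h
    have h1 : (((n + 1 : ℕ) : ℝ) * ((n + 1 : ℕ) + a + b + 1) : ℝ) ≠ 0 :=
      (mul_pos (by positivity) (by push_cast; linarith)).ne'
    refine mul_left_cancel₀ (Complex.ofReal_ne_zero.2 h1) (h.trans ?_)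
    norm_cast
    have e1 : ((n + 1 : ℕ) : ℝ) + a + b + 1 = n + a + b + 2 := by push_cast; ring
    have e2 : (n : ℝ) + a + b + 2 + 1 = n + (a + 1) + (b + 1) + 1 := by ring
    have e3 : a + ((n + 1 : ℕ) : ℝ) + 1 = a + 1 + n + 1 := by push_cast; ring
    have e4 : b + ((n + 1 : ℕ) : ℝ) + 1 = b + 1 + n + 1 := by push_cast; ring
    have e5 : 2 * ((n + 1 : ℕ) : ℝ) + a + b + 2 = 2 * n + (a + 1) + (b + 1) + 2 := by
      push_cast; ring
    have e6 : a + b + 2 * ((n + 1 : ℕ) : ℝ) + 1 = a + 1 + (b + 1) + 2 * n + 1 := by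
      push_cast; ring
    rw [jacobiSqNorm, jacobiSqNorm, risingFactorial_succ_left, Nat.factorial_succ, e1, e2, e3, e4,
      e5, e6]
    have h2 : (n : ℝ) + a + b + 2 ≠ 0 := by linarith
    push_cast
    field_simp

lemma jacobiSqNorm_pos {a b : ℝ} (ha : -1 < a) (hb : -1 < b) (n : ℕ) :
    0 < jacobiSqNorm a b n := by
  have hn : (0 : ℝ) ≤ n := n.cast_nonneg
  have h1 : 0 < risingFactorial ((n : ℝ) + a + b + 1) n := risingFactorial_pos fun h => by
    have : (1 : ℝ) ≤ n := by exact_mod_cast Nat.one_le_iff_ne_zero.2 h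
    linarith
  have h2 : 0 < Real.Gamma (a + n + 1) := Real.Gamma_pos_of_pos (by linarith)
  have h3 : 0 < Real.Gamma (b + n + 1) := Real.Gamma_pos_of_pos (by linarith)
  have h4 : 0 < Real.Gamma (2 * n + a + b + 2) := Real.Gamma_pos_of_pos (by linarith)
  have h5 : (0 : ℝ) < n.factorial := by exact_mod_cast n.factorial_pos
  unfold jacobiSqNorm
  positivity

lemma jacobiIntegral_mul_of_degree_lt {a b : ℝ} (ha : -1 < a) (hb : -1 < b) {n : ℕ} {f : ℂ[X]}
    (hf : f.degree < n) : jacobiIntegral ha hb (jacobiPoly a b n * f) = 0 :=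
  linearMap_eq_zero_of_degree_lt (monic_jacobiPoly ha hb) (natDegree_jacobiPoly ha hb)
    (jacobiIntegral ha hb ∘ₗ LinearMap.mulLeft ℂ (jacobiPoly a b n))
    (fun i hi => by simpa using jacobiIntegral_mul_of_ne ha hb hi.ne') hf

/-- Minus the leading coefficient of `jacobiSkewOp a b p` for monic `p` of degree `n`. -/
noncomputable def jacobiSkewCoeff (a b : ℝ) (n : ℕ) : ℝ := n + (a + b + 2) / 2

lemma jacobiSkewCoeff_pos {a b : ℝ} (ha : -1 < a) (hb : -1 < b) (n : ℕ) :
    0 < jacobiSkewCoeff a b n := by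
  have hn : (0 : ℝ) ≤ n := n.cast_nonneg
  unfold jacobiSkewCoeff
  linarith

lemma coeff_jacobiSkewOp (a b : ℝ) (f : ℂ[X]) (k : ℕ) :
    (jacobiSkewOp a b f).coeff (k + 1) = f.coeff (k + 2) * (k + 2) +
      ((b - a : ℝ) : ℂ) / 2 * f.coeff (k + 1) -
      (jacobiSkewCoeff a b k : ℂ) * f.coeff k := by
  have e : jacobiSkewOp a b f = derivative f - derivative f * X * X +
      (C (1 / 2 * ((b - a : ℝ) : ℂ)) * f - C (1 / 2 * ((a + b + 2 : ℝ) : ℂ)) * (f * X)) := by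
    rw [jacobiSkewOp_eq, C_mul, C_mul]; ring
  rw [e, jacobiSkewCoeff]
  rcases k with _ | k
  · simp only [coeff_add, coeff_sub, coeff_mul_X, coeff_mul_X_zero, coeff_C_mul, coeff_derivative]
    push_cast; ring
  · simp only [coeff_add, coeff_sub, coeff_mul_X, coeff_C_mul, coeff_derivative]
    push_cast; ring

lemma degree_jacobiSkewOp_add_lt {a b : ℝ} (ha : -1 < a) (hb : -1 < b) (n : ℕ) :
    (jacobiSkewOp a b (jacobiPoly a b n) +
      (jacobiSkewCoeff a b n : ℂ) • jacobiPoly a b (n + 1)).degree < (n + 1 : ℕ) := by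
  rw [degree_lt_iff_coeff_zero]
  intro k hk
  obtain ⟨k, rfl⟩ : ∃ l, k = l + 1 := ⟨k - 1, by omega⟩
  have hz (m l : ℕ) (h : m < l) : (jacobiPoly a b m).coeff l = 0 :=
    coeff_eq_zero_of_natDegree_lt (by rwa [natDegree_jacobiPoly ha hb])
  rw [coeff_add, coeff_jacobiSkewOp, coeff_smul, hz n (k + 2) (by omega), hz n (k + 1) (by omega)]
  rcases (Nat.le_of_succ_le_succ hk).eq_or_lt with rfl | hk
  · simp [coeff_jacobiPoly_self ha hb]
  · rw [hz n k hk, hz (n + 1) (k + 1) (by omega)]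
    simp

/-- D p_n has degree n+1 with known leading coefficient, so against p_m with m > n only m = n+1
survives. Skew-adjointness supplies the entries with m < n and kills the diagonal. -/
lemma jacobiIntegral_mul_jacobiSkewOp_of_lt {a b : ℝ} (ha : -1 < a) (hb : -1 < b) {m n : ℕ}
    (h : n < m) :
    jacobiIntegral ha hb (jacobiPoly a b m * jacobiSkewOp a b (jacobiPoly a b n)) =
      if m = n + 1 then -((jacobiSkewCoeff a b n * jacobiSqNorm a b (n + 1) : ℝ) : ℂ) else 0 := by
  have h1 := jacobiIntegral_mul_of_degree_lt ha hb (n := m)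
    ((degree_jacobiSkewOp_add_lt ha hb n).trans_le (by exact_mod_cast h))
  rw [mul_add, map_add, mul_smul_comm, map_smul, smul_eq_mul] at h1
  rw [eq_neg_of_add_eq_zero_left h1]
  split_ifs with hm
  · subst hm
    rw [jacobiIntegral_mul_self]; push_cast; ring
  · rw [jacobiIntegral_mul_of_ne ha hb hm]; simp

lemma jacobiIntegral_mul_jacobiSkewOp_self {a b : ℝ} (ha : -1 < a) (hb : -1 < b) (f : ℂ[X]) :
    jacobiIntegral ha hb (f * jacobiSkewOp a b f) = 0 := by
  have h := jacobiIntegral_mul_jacobiSkewOp ha hb f f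
  rw [mul_comm (jacobiSkewOp a b f)] at h
  exact self_eq_neg.1 h

lemma jacobiIntegral_jacobiPoly_jacobiSkewOp {a b : ℝ} (ha : -1 < a) (hb : -1 < b) (m n : ℕ) :
    jacobiIntegral ha hb (jacobiPoly a b m * jacobiSkewOp a b (jacobiPoly a b n)) =
      if m = n + 1 then -((jacobiSkewCoeff a b n * jacobiSqNorm a b (n + 1) : ℝ) : ℂ)
      else if n = m + 1 then ((jacobiSkewCoeff a b m * jacobiSqNorm a b (m + 1) : ℝ) : ℂ)
      else 0 := by
  rcases lt_trichotomy m n with h | rfl | h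
  · rw [jacobiIntegral_mul_jacobiSkewOp, mul_comm, jacobiIntegral_mul_jacobiSkewOp_of_lt ha hb h,
      if_neg (show ¬m = n + 1 by omega)]
    split_ifs <;> simp
  · rw [jacobiIntegral_mul_jacobiSkewOp_self]; simp
  · rw [jacobiIntegral_mul_jacobiSkewOp_of_lt ha hb h, if_neg (show ¬n = m + 1 by omega)]

/-- The pairing `(f, g) ↦ ∫ f g` for the Jacobi weight. -/
noncomputable def jacobiPairing {a b : ℝ} (ha : -1 < a) (hb : -1 < b) :
    ℂ[X] →ₗ[ℂ] ℂ[X] →ₗ[ℂ] ℂ :=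
  (LinearMap.mul ℂ ℂ[X]).compr₂ (jacobiIntegral ha hb)

lemma eq_zero_of_jacobiIntegral_mul {a b : ℝ} (ha : -1 < a) (hb : -1 < b) {n : ℕ} {f : ℂ[X]}
    (hf : f.degree < n) (h : ∀ j < n, jacobiIntegral ha hb (f * jacobiPoly a b j) = 0) :
    f = 0 := by
  refine eq_zero_of_bilin_eq_zero (monic_jacobiPoly ha hb) (natDegree_jacobiPoly ha hb)
    (jacobiPairing ha hb) id (fun i hi => hi) (fun i _ => ?_) (fun i _ j _ hji => ?_) hf h
  · exact (jacobiIntegral_mul_self i ha hb).trans_ne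
      (Complex.ofReal_ne_zero.2 (jacobiSqNorm_pos ha hb i).ne')
  · exact jacobiIntegral_mul_of_ne ha hb hji

lemma jacobiSkewOp_jacobiPoly_zero {a b : ℝ} (ha : -1 < a) (hb : -1 < b) :
    jacobiSkewOp a b (jacobiPoly a b 0) = -((jacobiSkewCoeff a b 0 : ℂ) • jacobiPoly a b 1) := by
  rw [eq_neg_iff_add_eq_zero]
  refine eq_zero_of_jacobiIntegral_mul ha hb (degree_jacobiSkewOp_add_lt ha hb 0) fun j hj => ?_
  obtain rfl : j = 0 := by omega
  rw [mul_comm, mul_add, map_add, jacobiIntegral_mul_jacobiSkewOp_self, mul_smul_comm, map_smul,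
    jacobiIntegral_mul_of_ne ha hb zero_ne_one]
  simp

/-- Both sides have the same integrals against p_0, …, p_{n+1}, and their difference has degree at
most n+1. -/
lemma jacobiSkewOp_jacobiPoly_succ {a b : ℝ} (ha : -1 < a) (hb : -1 < b) (n : ℕ) :
    jacobiSkewOp a b (jacobiPoly a b (n + 1)) =
      ((jacobiSkewCoeff a b n * jacobiSqNorm a b (n + 1) / jacobiSqNorm a b n : ℝ) : ℂ) •
        jacobiPoly a b n - (jacobiSkewCoeff a b (n + 1) : ℂ) • jacobiPoly a b (n + 2) := by
  rw [eq_sub_iff_add_eq, ← sub_eq_zero]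
  refine eq_zero_of_jacobiIntegral_mul ha hb (n := n + 2) ?_ fun j hj => ?_
  · refine (degree_sub_le _ _).trans_lt (max_lt (degree_jacobiSkewOp_add_lt ha hb (n + 1)) ?_)
    refine (degree_smul_le _ _).trans_lt ((degree_le_natDegree).trans_lt ?_)
    rw [natDegree_jacobiPoly ha hb]
    exact_mod_cast (by omega)
  · rw [mul_comm, mul_sub, mul_add, map_sub, map_add, mul_smul_comm, map_smul, mul_smul_comm,
      map_smul, jacobiIntegral_jacobiPoly_jacobiSkewOp,
      jacobiIntegral_mul_of_ne ha hb (by omega : j ≠ n + 2), if_neg (by omega), smul_zero, add_zero]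
    split_ifs with h
    · obtain rfl : n = j := by omega
      rw [jacobiIntegral_mul_self, smul_eq_mul, ← Complex.ofReal_mul,
        div_mul_cancel₀ _ (jacobiSqNorm_pos ha hb n).ne', sub_self]
    · rw [jacobiIntegral_mul_of_ne ha hb (by omega)]
      simp

end JacobiOrthogonality

/-! ### Closed forms of the norms and rational relations between them. -/

section JacobiNorms

open Real

lemma Gamma_add_nat {x : ℝ} (hx : 0 < x) (k : ℕ) :
    Gamma (x + k) = risingFactorial x k * Gamma x := by
  induction k with
  | zero => simp
  | succ k ih =>
    have : x + k ≠ 0 := by positivity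
    rw [Nat.cast_succ, ← add_assoc, Gamma_add_one this, ih, risingFactorial_succ]
    ring

variable {a b : ℝ}

lemma jacobiNormFour_eq (ha : -1 < a) (hb : -1 < b) (n : ℕ) :
    jacobiNormFour a b n = jacobiSkewCoeff a b n * jacobiSqNorm a b (n + 1) := by
  have hn : (0 : ℝ) ≤ n := n.cast_nonneg
  have h0 : (0 : ℝ) < n + a + b + 2 := by linarith
  have h1 : (0 : ℝ) < 2 * n + a + b + 2 := by linarith
  have h2 := Gamma_add_nat h0 (n + 1)
  have e1 : (n : ℝ) + a + b + 2 + (n + 1 : ℕ) = 2 * n + a + b + 2 + 1 := by push_cast; ring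
  rw [e1, Gamma_add_one h1.ne'] at h2
  have h3 := (Gamma_pos_of_pos h0).ne'
  have h4 := (Gamma_pos_of_pos h1).ne'
  have h5 : (0 : ℝ) < risingFactorial ((n : ℝ) + a + b + 2) (n + 1) :=
    risingFactorial_pos fun _ => h0
  have e2 : ((n + 1 : ℕ) : ℝ) + a + b + 1 = n + a + b + 2 := by push_cast; ring
  have e3 : a + ((n + 1 : ℕ) : ℝ) + 1 = n + a + 2 := by push_cast; ring
  have e4 : b + ((n + 1 : ℕ) : ℝ) + 1 = n + b + 2 := by push_cast; ring
  have e5 : 2 * ((n + 1 : ℕ) : ℝ) + a + b + 2 = 2 * n + a + b + 4 := by push_cast; ring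
  have e6 : a + b + 2 * ((n + 1 : ℕ) : ℝ) + 1 = a + b + 2 * n + 2 + 1 := by push_cast; ring
  have e7 : Gamma ((n : ℝ) + 2) = ((n + 1).factorial : ℝ) := by
    rw [← Gamma_nat_eq_factorial]; push_cast; ring_nf
  have e8 : jacobiSkewCoeff a b n = (2 * n + a + b + 2) / 2 := by
    rw [jacobiSkewCoeff]; ring
  rw [jacobiNormFour, jacobiSqNorm, e2, e3, e4, e5, e6, e7, e8, rpow_add_one two_ne_zero]
  have e9 : risingFactorial ((n : ℝ) + a + b + 2) (n + 1) =
      (2 * n + a + b + 2) * Gamma (2 * n + a + b + 2) / Gamma (n + a + b + 2) := by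
    rw [h2]; field_simp
  rw [e9]
  field_simp

lemma jacobiNormOne_eq (ha : -1 < a) (hb : -1 < b) (n : ℕ) :
    jacobiNormOne a b n = jacobiSqNorm a b (2 * n) / jacobiSkewCoeff a b (2 * n) := by
  have hn : (0 : ℝ) ≤ n := n.cast_nonneg
  have h1 : (0 : ℝ) < 4 * n + a + b + 2 := by linarith
  have h2 : jacobiSkewCoeff a b (2 * n) = (4 * n + a + b + 2) / 2 := by
    rw [jacobiSkewCoeff]; push_cast; ring
  have h3 : Gamma (4 * n + a + b + 3) = (4 * n + a + b + 2) * Gamma (4 * n + a + b + 2) := by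
    rw [← Gamma_add_one h1.ne']; ring_nf
  have h4 : Gamma (2 * (n : ℝ) + 1) = ((2 * n).factorial : ℝ) := by
    rw [← Gamma_nat_eq_factorial]; push_cast; ring_nf
  -- For n = 0 the base a+b+1 may fail to be positive, so the Gamma quotient is unavailable; the
  -- empty rising factorial matches the convention 1.
  have h5 : (if n = 0 then (1 : ℝ) else Gamma (2 * n + a + b + 1) / Gamma (4 * n + a + b + 1)) =
      (risingFactorial (2 * (n : ℝ) + a + b + 1) (2 * n))⁻¹ := by
    split_ifs with h
    · simp [h]
    · have h6 : (1 : ℝ) ≤ n := by exact_mod_cast Nat.one_le_iff_ne_zero.2 h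
      have h7 : (0 : ℝ) < 2 * n + a + b + 1 := by linarith
      have h8 := Gamma_add_nat h7 (2 * n)
      have e : 2 * (n : ℝ) + a + b + 1 + (2 * n : ℕ) = 4 * n + a + b + 1 := by push_cast; ring
      rw [e] at h8
      have h9 := (Gamma_pos_of_pos h7).ne'
      rw [h8, div_mul_cancel_right₀ h9]
  rw [jacobiNormOne, jacobiSqNorm, h2, h3, h4, h5]
  have e1 : a + b + 2 * ((2 * n : ℕ) : ℝ) + 1 = a + b + 4 * n + 1 := by push_cast; ring
  have e2 : a + b + 4 * (n : ℝ) + 2 = a + b + 4 * n + 1 + 1 := by ring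
  have e3 : 2 * ((2 * n : ℕ) : ℝ) + a + b + 2 = 4 * n + a + b + 2 := by push_cast; ring
  have e4 : ((2 * n : ℕ) : ℝ) = 2 * n := by push_cast; ring
  rw [e1, e2, e3, e4, rpow_add_one two_ne_zero, add_comm a (2 * (n : ℝ)), add_comm b (2 * (n : ℝ))]
  field_simp

lemma jacobiNormFour_pos (ha : -1 < a) (hb : -1 < b) (n : ℕ) : 0 < jacobiNormFour a b n := by
  rw [jacobiNormFour_eq ha hb]
  exact mul_pos (jacobiSkewCoeff_pos ha hb n) (jacobiSqNorm_pos ha hb _)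

lemma jacobiNormOne_pos (ha : -1 < a) (hb : -1 < b) (n : ℕ) : 0 < jacobiNormOne a b n := by
  rw [jacobiNormOne_eq ha hb]
  exact div_pos (jacobiSqNorm_pos ha hb _) (jacobiSkewCoeff_pos ha hb _)

/-- Together with the link between the two norms, this ratio makes the later identities rational,
with no Gamma functions left in the norms. -/
lemma jacobiNormFour_succ (ha : -1 < a) (hb : -1 < b) (n : ℕ) :
    jacobiNormFour a b (n + 1) = 4 * (n + 2) * (n + a + 2) * (n + b + 2) * (n + a + b + 2) /
      ((2 * n + a + b + 2) * (2 * n + a + b + 3) * (2 * n + a + b + 4) * (2 * n + a + b + 5)) *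
      jacobiNormFour a b n := by
  have hn : (0 : ℝ) ≤ n := n.cast_nonneg
  have g (x y : ℝ) (hx : 0 < x) (h : y = x + 1) : Gamma y = x * Gamma x := by
    rw [h, Gamma_add_one hx.ne']
  simp only [jacobiNormFour, Nat.cast_succ]
  rw [g (n + 2) (n + 1 + 2) (by positivity) (by ring),
    g (n + a + 2) (n + 1 + a + 2) (by linarith) (by ring),
    g (n + b + 2) (n + 1 + b + 2) (by linarith) (by ring),
    g (n + a + b + 2) (n + 1 + a + b + 2) (by linarith) (by ring),
    g (2 * n + a + b + 3) (2 * (n + 1) + a + b + 2) (by linarith) (by ring),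
    g (2 * n + a + b + 2) (2 * n + a + b + 3) (by linarith) (by ring),
    g (2 * n + a + b + 5) (2 * (n + 1) + a + b + 4) (by linarith) (by ring),
    g (2 * n + a + b + 4) (2 * n + a + b + 5) (by linarith) (by ring)]
  have e : a + b + 2 * ((n : ℝ) + 1) + 2 = a + b + 2 * n + 2 + 2 := by ring
  rw [e, rpow_add two_pos (a + b + 2 * n + 2) 2]
  have h1 : (0 : ℝ) < 2 * n + a + b + 2 := by linarith
  have h2 : (0 : ℝ) < 2 * n + a + b + 3 := by linarith
  have h3 : (0 : ℝ) < 2 * n + a + b + 4 := by linarith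
  have h4 : (0 : ℝ) < 2 * n + a + b + 5 := by linarith
  have h5 := (Gamma_pos_of_pos h1).ne'
  have h6 := (Gamma_pos_of_pos h3).ne'
  norm_num
  field_simp

lemma jacobiZeta_succ (a b : ℝ) (n : ℕ) :
    jacobiZeta a b (n + 1) =
      8 * (n + 1) * (2 * n + a + 2) * (2 * n + b + 2) * (2 * n + a + b + 2) /
        ((4 * n + a + b + 3) * (4 * n + a + b + 4) * (4 * n + a + b + 5) *
          (4 * n + a + b + 6)) := by
  rw [jacobiZeta]
  push_cast
  congr 1 <;> ring

/-- The identity behind the choice of ζ. It makes q_n proportional to D p_{2n}, and it makes the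
factor 4j+a+b+2 in ξ_j exchange the two recurrences. -/
lemma jacobiZeta_mul_jacobiNormFour (ha : -1 < a) (hb : -1 < b) (n : ℕ) :
    jacobiZeta a b (n + 1) * jacobiNormFour a b (2 * n) * (4 * n + a + b + 6) =
      jacobiNormFour a b (2 * n + 1) * (4 * n + a + b + 2) := by
  have hn : (0 : ℝ) ≤ n := n.cast_nonneg
  have h1 : (0 : ℝ) < 4 * n + a + b + 2 := by linarith
  have h2 : (0 : ℝ) < 4 * n + a + b + 3 := by linarith
  have h3 : (0 : ℝ) < 4 * n + a + b + 4 := by linarith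
  have h4 : (0 : ℝ) < 4 * n + a + b + 5 := by linarith
  have h5 : (0 : ℝ) < 4 * n + a + b + 6 := by linarith
  rw [jacobiNormFour_succ ha hb, jacobiZeta_succ]
  push_cast
  have e1 : 2 * (2 * (n : ℝ)) + a + b + 2 = 4 * n + a + b + 2 := by ring
  have e2 : 2 * (2 * (n : ℝ)) + a + b + 3 = 4 * n + a + b + 3 := by ring
  have e3 : 2 * (2 * (n : ℝ)) + a + b + 4 = 4 * n + a + b + 4 := by ring
  have e4 : 2 * (2 * (n : ℝ)) + a + b + 5 = 4 * n + a + b + 5 := by ring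
  rw [e1, e2, e3, e4]
  have e5 : 4 * (2 * (n : ℝ) + 2) * (2 * n + a + 2) * (2 * n + b + 2) * (2 * n + a + b + 2) =
      8 * (n + 1) * (2 * n + a + 2) * (2 * n + b + 2) * (2 * n + a + b + 2) := by ring
  rw [e5]
  -- Only cancellation remains, so the linear factors are made opaque.
  generalize 8 * ((n : ℝ) + 1) * (2 * n + a + 2) * (2 * n + b + 2) * (2 * n + a + b + 2) = N
  generalize 4 * (n : ℝ) + a + b + 2 = s2 at *
  generalize 4 * (n : ℝ) + a + b + 3 = s3 at *
  generalize 4 * (n : ℝ) + a + b + 4 = s4 at *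
  generalize 4 * (n : ℝ) + a + b + 5 = s5 at *
  generalize 4 * (n : ℝ) + a + b + 6 = s6 at *
  field_simp

lemma jacobiZeta_pos (ha : -1 < a) (hb : -1 < b) (n : ℕ) : 0 < jacobiZeta a b (n + 1) := by
  have hn : (0 : ℝ) ≤ n := n.cast_nonneg
  have h1 : (0 : ℝ) < 4 * n + a + b + 2 := by linarith
  have h5 : (0 : ℝ) < 4 * n + a + b + 6 := by linarith
  have h := jacobiZeta_mul_jacobiNormFour ha hb n
  have h6 : 0 < jacobiNormFour a b (2 * n) * (4 * n + a + b + 6) :=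
    mul_pos (jacobiNormFour_pos ha hb _) h5
  rw [mul_assoc] at h
  exact (pos_iff_pos_of_mul_pos (h ▸ mul_pos (jacobiNormFour_pos ha hb _) h1)).2 h6

end JacobiNorms

/-! ### Values of the two skew forms on the p_n and q_n. -/

section SkewRelations

open Polynomial

variable {a b : ℝ}

lemma jacobiOdd_eq (ha : -1 < a) (hb : -1 < b) (n : ℕ) :
    jacobiOdd a b n = (-(jacobiSkewCoeff a b (2 * n) : ℂ)⁻¹) •
      jacobiSkewOp a b (jacobiPoly a b (2 * n)) := by
  have hc (n : ℕ) : (jacobiSkewCoeff a b n : ℂ) ≠ 0 :=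
    Complex.ofReal_ne_zero.2 (jacobiSkewCoeff_pos ha hb n).ne'
  rcases n with _ | n
  · rw [jacobiOdd, mul_zero, jacobiSkewOp_jacobiPoly_zero ha hb, smul_neg, neg_smul, neg_neg,
      smul_smul, inv_mul_cancel₀ (hc 0), one_smul]
  -- ζ_{n+1} is the ratio of the two coefficients of D p_{2n+2}, up to sign.
  · have hz : jacobiZeta a b (n + 1) = (jacobiSkewCoeff a b (2 * n + 2))⁻¹ *
        (jacobiSkewCoeff a b (2 * n + 1) * jacobiSqNorm a b (2 * n + 2) /
          jacobiSqNorm a b (2 * n + 1)) := by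
      have h := jacobiZeta_mul_jacobiNormFour ha hb n
      rw [jacobiNormFour_eq ha hb, jacobiNormFour_eq ha hb] at h
      have h1 := (jacobiSkewCoeff_pos ha hb (2 * n + 2)).ne'
      have h2 := (jacobiSqNorm_pos ha hb (2 * n + 1)).ne'
      have h3 := (jacobiSkewCoeff_pos ha hb (2 * n)).ne'
      have e1 : (4 * n + a + b + 6 : ℝ) = 2 * jacobiSkewCoeff a b (2 * n + 2) := by
        rw [jacobiSkewCoeff]; push_cast; ring
      have e2 : (4 * n + a + b + 2 : ℝ) = 2 * jacobiSkewCoeff a b (2 * n) := by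
        rw [jacobiSkewCoeff]; push_cast; ring
      rw [e1, e2] at h
      field_simp
      refine mul_left_cancel₀ h3 (mul_left_cancel₀ two_ne_zero ?_)
      linear_combination h
    rw [jacobiOdd, show 2 * (n + 1) = 2 * n + 1 + 1 by ring,
      jacobiSkewOp_jacobiPoly_succ ha hb, hz, smul_sub, smul_smul, smul_smul, neg_mul, neg_mul,
      inv_mul_cancel₀ (hc _), ← smul_eq_C_mul, neg_smul, neg_smul, one_smul, Complex.ofReal_mul,
      Complex.ofReal_inv]
    abel

lemma skewOne_jacobiOdd (ha : -1 < a) (hb : -1 < b) (f : ℂ[X]) (n : ℕ) :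
    skewOne a b f (jacobiOdd a b n) = (jacobiSkewCoeff a b (2 * n) : ℂ)⁻¹ *
      jacobiIntegral ha hb (f * jacobiPoly a b (2 * n)) := by
  rw [jacobiOdd_eq ha hb, ← skewOneBilin_apply ha hb, map_smul, skewOneBilin_apply,
    skewOne_jacobiSkewOp ha hb, smul_eq_mul]
  ring

lemma skewOne_even_odd (ha : -1 < a) (hb : -1 < b) (m n : ℕ) :
    skewOne a b (jacobiPoly a b (2 * m)) (jacobiOdd a b n) =
      if m = n then (jacobiNormOne a b n : ℂ) else 0 := by
  rw [skewOne_jacobiOdd ha hb]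
  split_ifs with h
  · rw [h, jacobiIntegral_mul_self, jacobiNormOne_eq ha hb]
    push_cast; ring
  · rw [jacobiIntegral_mul_of_ne ha hb (by omega), mul_zero]

lemma jacobiIntegral_jacobiOdd_mul (ha : -1 < a) (hb : -1 < b) (m n : ℕ) :
    jacobiIntegral ha hb (jacobiOdd a b m * jacobiPoly a b (2 * n)) = 0 := by
  rcases m with _ | m
  · exact jacobiIntegral_mul_of_ne ha hb (by omega)
  · rw [jacobiOdd, sub_mul, map_sub, mul_assoc, ← smul_eq_C_mul, map_smul,
      jacobiIntegral_mul_of_ne ha hb (by omega), jacobiIntegral_mul_of_ne ha hb (by omega)]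
    simp

lemma skewOne_odd_odd (ha : -1 < a) (hb : -1 < b) (m n : ℕ) :
    skewOne a b (jacobiOdd a b m) (jacobiOdd a b n) = 0 := by
  rw [skewOne_jacobiOdd ha hb, jacobiIntegral_jacobiOdd_mul, mul_zero]

lemma skewOne_self (ha : -1 < a) (hb : -1 < b) (f : ℂ[X]) : skewOne a b f f = 0 :=
  self_eq_neg.1 (skewOne_swap ha hb f f)

/-- D p_{2n+1} combines p_{2n} and p_{2n+2}, and its first form with p_{2m} is -∫p_{2m}p_{2n+1}w =
0; hence vanishing passes from n to n+1. Skew symmetry starts the induction. -/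
lemma skewOne_even_succ (ha : -1 < a) (hb : -1 < b) {m n : ℕ}
    (h : skewOne a b (jacobiPoly a b (2 * m)) (jacobiPoly a b (2 * n)) = 0) :
    skewOne a b (jacobiPoly a b (2 * m)) (jacobiPoly a b (2 * (n + 1))) = 0 := by
  have h1 := skewOne_jacobiSkewOp ha hb (jacobiPoly a b (2 * m)) (jacobiPoly a b (2 * n + 1))
  rw [jacobiSkewOp_jacobiPoly_succ ha hb, ← skewOneBilin_apply ha hb, map_sub, map_smul, map_smul,
    skewOneBilin_apply, skewOneBilin_apply, h, jacobiIntegral_mul_of_ne ha hb (by omega)] at h1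
  simp only [zero_sub, neg_zero, neg_eq_zero, smul_eq_mul, mul_zero, mul_eq_zero] at h1
  exact h1.resolve_left (Complex.ofReal_ne_zero.2 (jacobiSkewCoeff_pos ha hb _).ne')

lemma skewOne_even_even (ha : -1 < a) (hb : -1 < b) (m n : ℕ) :
    skewOne a b (jacobiPoly a b (2 * m)) (jacobiPoly a b (2 * n)) = 0 := by
  have h0 (n : ℕ) : skewOne a b (jacobiPoly a b (2 * 0)) (jacobiPoly a b (2 * n)) = 0 := by
    induction n with
    | zero => exact skewOne_self ha hb _
    | succ n ih => exact skewOne_even_succ ha hb ih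
  induction n with
  | zero => rw [skewOne_swap ha hb, h0, neg_zero]
  | succ n ih => exact skewOne_even_succ ha hb ih

lemma skewFour_jacobiPoly (ha : -1 < a) (hb : -1 < b) (m n : ℕ) :
    skewFour a b (jacobiPoly a b m) (jacobiPoly a b n) =
      if m = n + 1 then -(jacobiNormFour a b n : ℂ)
      else if n = m + 1 then (jacobiNormFour a b m : ℂ) else 0 := by
  rw [skewFour_eq ha hb, jacobiIntegral_jacobiPoly_jacobiSkewOp, jacobiNormFour_eq ha hb,
    jacobiNormFour_eq ha hb]

lemma skewFour_even_odd (ha : -1 < a) (hb : -1 < b) (m n : ℕ) :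
    skewFour a b (jacobiPoly a b (2 * m)) (jacobiPoly a b (2 * n + 1)) =
      if m = n then (jacobiNormFour a b (2 * n) : ℂ)
      else if m = n + 1 then -(jacobiNormFour a b (2 * n + 1) : ℂ) else 0 := by
  rw [skewFour_jacobiPoly ha hb]
  by_cases h : m = n
  · subst h
    rw [if_neg (by omega), if_pos rfl, if_pos rfl]
  · rw [if_neg h]
    by_cases h' : m = n + 1
    · subst h'; simp [mul_add]
    · rw [if_neg h', if_neg (by omega), if_neg (by omega)]

lemma skewFour_even_even (ha : -1 < a) (hb : -1 < b) (m n : ℕ) :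
    skewFour a b (jacobiPoly a b (2 * m)) (jacobiPoly a b (2 * n)) = 0 := by
  rw [skewFour_jacobiPoly ha hb, if_neg (by omega), if_neg (by omega)]

lemma skewFour_odd_odd (ha : -1 < a) (hb : -1 < b) (m n : ℕ) :
    skewFour a b (jacobiPoly a b (2 * m + 1)) (jacobiPoly a b (2 * n + 1)) = 0 := by
  rw [skewFour_jacobiPoly ha hb, if_neg (by omega), if_neg (by omega)]

end SkewRelations

/-! ### The three-term recurrence of the Wilson polynomials. -/

section Wilson

/-- The coefficients of the Wilson polynomial in the basis `∏_{l < k} ((A + l)² + y)`, with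
`s = A + B + C + D - 1`, `d₁ = A + B`, `d₂ = A + C`, `d₃ = A + D`. -/
noncomputable def wilsonCoeff (s d₁ d₂ d₃ : ℂ) (n k : ℕ) : ℂ :=
  risingFactorial (-(n : ℂ)) k * risingFactorial (n + s) k /
    (risingFactorial d₁ k * risingFactorial d₂ k * risingFactorial d₃ k * (k.factorial : ℂ))

lemma wilsonCoeff_of_lt (s d₁ d₂ d₃ : ℂ) {n k : ℕ} (h : n < k) :
    wilsonCoeff s d₁ d₂ d₃ n k = 0 := by
  rw [wilsonCoeff, risingFactorial_neg_of_lt h]; simp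

@[simp] lemma wilsonCoeff_zero (s d₁ d₂ d₃ : ℂ) (n : ℕ) : wilsonCoeff s d₁ d₂ d₃ n 0 = 1 := by
  simp [wilsonCoeff]

lemma wilsonCoeff_one (s d₁ d₂ d₃ : ℂ) (n : ℕ) :
    wilsonCoeff s d₁ d₂ d₃ n 1 = -n * (n + s) / (d₁ * d₂ * d₃) := by
  simp [wilsonCoeff]

lemma wilson_eq_sum_range (y A B C D : ℂ) {n N : ℕ} (h : n < N) :
    wilson n y A B C D = ∑ k ∈ Finset.range N,
      wilsonCoeff (A + B + C + D - 1) (A + B) (A + C) (A + D) n k *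
        ∏ l ∈ Finset.range k, ((A + (l : ℂ)) ^ 2 + y) := by
  rw [← Finset.sum_subset (Finset.range_mono (Nat.succ_le_of_lt h)), wilson]
  · refine Finset.sum_congr rfl fun k _ => ?_
    have e : (n : ℂ) + A + B + C + D - 1 = n + (A + B + C + D - 1) := by ring
    rw [wilsonCoeff, e]
    ring
  · intro k _ hk
    rw [wilsonCoeff_of_lt _ _ _ _ (by simpa using hk), zero_mul]

/-- The coefficientwise form of the recurrence of the Wilson polynomials in the degree. -/
lemma wilsonCoeff_recurrence (s d₁ d₂ d₃ U V : ℂ) (m k : ℕ)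
    (h1 : risingFactorial d₁ (k + 1) ≠ 0) (h2 : risingFactorial d₂ (k + 1) ≠ 0)
    (h3 : risingFactorial d₃ (k + 1) ≠ 0)
    (hs0 : (m : ℂ) + 1 + s ≠ 0) (hs1 : 2 * (m : ℂ) + 1 + s ≠ 0) (hs2 : 2 * (m : ℂ) + 2 + s ≠ 0)
    (hs3 : 2 * (m : ℂ) + 3 + s ≠ 0)
    (hU : U * ((2 * (m : ℂ) + 2 + s) * (2 * m + 3 + s)) =
      (m + 1 + s) * (m + 1 + d₁) * (m + 1 + d₂) * (m + 1 + d₃))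
    (hV : V * ((2 * (m : ℂ) + 1 + s) * (2 * m + 2 + s)) =
      (m + 1) * (m + 1 + s - d₁) * (m + 1 + s - d₂) * (m + 1 + s - d₃)) :
    U * (wilsonCoeff s d₁ d₂ d₃ (m + 2) (k + 1) - wilsonCoeff s d₁ d₂ d₃ (m + 1) (k + 1)) +
      V * (wilsonCoeff s d₁ d₂ d₃ m (k + 1) - wilsonCoeff s d₁ d₂ d₃ (m + 1) (k + 1)) -
      (k + 1) * (d₁ + d₂ + d₃ - s + k) * wilsonCoeff s d₁ d₂ d₃ (m + 1) (k + 1) =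
      -wilsonCoeff s d₁ d₂ d₃ (m + 1) k := by
  -- All four coefficients are polynomial multiples of one quantity t, after which the claim is a
  -- polynomial identity modulo `hU` and `hV`.
  have key : ∃ t : ℂ,
      wilsonCoeff s d₁ d₂ d₃ (m + 2) (k + 1) =
        (m + 2) * (m + 1) * (m + k + 1 + s) * (m + k + 2 + s) * t ∧
      wilsonCoeff s d₁ d₂ d₃ (m + 1) (k + 1) =
        (m + 1) * (m + 1 - k) * (m + 1 + s) * (m + k + 1 + s) * t ∧
      wilsonCoeff s d₁ d₂ d₃ m (k + 1) =
        (m + 1 - k) * (m - k) * (m + s) * (m + 1 + s) * t ∧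
      wilsonCoeff s d₁ d₂ d₃ (m + 1) k =
        -(m + 1) * (m + 1 + s) * (d₁ + k) * (d₂ + k) * (d₃ + k) * (k + 1) * t := by
    have hm : (m : ℂ) + 1 ≠ 0 := Nat.cast_add_one_ne_zero m
    rcases k with _ | j
    · simp only [risingFactorial_one, zero_add] at h1 h2 h3
      -- This is the general witness at j = -1, with (x)_{-1} read as 1/(x-1).
      refine ⟨-1 / ((m + 1) * (m + 1 + s) * (d₁ * d₂ * d₃)), ?_, ?_, ?_, ?_⟩
      all_goals
        simp only [wilsonCoeff_one, zero_add, wilsonCoeff_zero]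
        push_cast
        field_simp
        ring
    · refine ⟨risingFactorial (-(m : ℂ)) j * risingFactorial (m + 2 + s) j /
        (risingFactorial d₁ (j + 2) * risingFactorial d₂ (j + 2) * risingFactorial d₃ (j + 2) *
          ((j + 2).factorial : ℂ)), ?_, ?_, ?_, ?_⟩
      · have e1 : risingFactorial (-((m + 2 : ℕ) : ℂ)) (j + 2) =
            (m + 2) * (m + 1) * risingFactorial (-(m : ℂ)) j := by
          rw [risingFactorial_succ_left, risingFactorial_succ_left]
          push_cast
          rw [show -((m : ℂ) + 2) + 1 + 1 = -m by ring]
          ring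
        have e2 : risingFactorial (((m + 2 : ℕ) : ℂ) + s) (j + 2) =
            (m + j + 2 + s) * (m + j + 3 + s) * risingFactorial (m + 2 + s) j := by
          rw [risingFactorial_succ, risingFactorial_succ]
          push_cast
          ring
        rw [wilsonCoeff, e1, e2]
        push_cast
        ring
      · have e1 : risingFactorial (-((m + 1 : ℕ) : ℂ)) (j + 2) =
            (m + 1) * (m - j) * risingFactorial (-(m : ℂ)) j := by
          rw [risingFactorial_succ_left, risingFactorial_succ]
          push_cast
          rw [show -((m : ℂ) + 1) + 1 = -m by ring]
          ring
        have e2 : risingFactorial (((m + 1 : ℕ) : ℂ) + s) (j + 2) =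
            (m + 1 + s) * (m + j + 2 + s) * risingFactorial (m + 2 + s) j := by
          rw [risingFactorial_succ_left, risingFactorial_succ]
          push_cast
          rw [show (m : ℂ) + 1 + s + 1 = m + 2 + s by ring]
          ring
        rw [wilsonCoeff, e1, e2]
        push_cast
        ring
      · have e1 : risingFactorial (-(m : ℂ)) (j + 2) =
            (m - j) * (m - j - 1) * risingFactorial (-(m : ℂ)) j := by
          rw [risingFactorial_succ, risingFactorial_succ]
          push_cast
          ring
        have e2 : risingFactorial ((m : ℂ) + s) (j + 2) =
            (m + s) * (m + 1 + s) * risingFactorial (m + 2 + s) j := by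
          rw [risingFactorial_succ_left, risingFactorial_succ_left]
          rw [show (m : ℂ) + s + 1 + 1 = m + 2 + s by ring]
          ring
        rw [wilsonCoeff, e1, e2]
        push_cast
        ring
      · have e1 : risingFactorial (-((m + 1 : ℕ) : ℂ)) (j + 1) =
            -(m + 1) * risingFactorial (-(m : ℂ)) j := by
          rw [risingFactorial_succ_left]
          push_cast
          rw [show -((m : ℂ) + 1) + 1 = -m by ring]
        have e2 : risingFactorial (((m + 1 : ℕ) : ℂ) + s) (j + 1) =
            (m + 1 + s) * risingFactorial (m + 2 + s) j := by
          rw [risingFactorial_succ_left]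
          push_cast
          rw [show (m : ℂ) + 1 + s + 1 = m + 2 + s by ring]
        have hf : ((j + 1).factorial : ℂ) ≠ 0 := by exact_mod_cast (j + 1).factorial_ne_zero
        have hj : (j : ℂ) + 1 + 1 ≠ 0 := by exact_mod_cast (j + 1).succ_ne_zero
        rw [risingFactorial_succ _ (j + 1)] at h1 h2 h3
        rw [wilsonCoeff, e1, e2, risingFactorial_succ d₁ (j + 1), risingFactorial_succ d₂ (j + 1),
          risingFactorial_succ d₃ (j + 1), Nat.factorial_succ (j + 1)]
        obtain ⟨h11, h12⟩ := mul_ne_zero_iff.1 h1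
        obtain ⟨h21, h22⟩ := mul_ne_zero_iff.1 h2
        obtain ⟨h31, h32⟩ := mul_ne_zero_iff.1 h3
        push_cast at h12 h22 h32 ⊢
        field_simp
  obtain ⟨t, e1, e2, e3, e4⟩ := key
  rw [e1, e2, e3, e4]
  refine mul_left_cancel₀ (mul_ne_zero (mul_ne_zero hs1 hs2) hs3) ?_
  linear_combination (2 * (m : ℂ) + 1 + s) * ((m + 2) * (m + 1) * (m + k + 1 + s) * (m + k + 2 + s)
      - (m + 1) * (m + 1 - k) * (m + 1 + s) * (m + k + 1 + s)) * t * hU +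
    (2 * (m : ℂ) + 3 + s) * ((m + 1 - k) * (m - k) * (m + s) * (m + 1 + s)
      - (m + 1) * (m + 1 - k) * (m + 1 + s) * (m + k + 1 + s)) * t * hV

/-- The three-term recurrence of the Wilson polynomials in the degree. -/
lemma wilson_recurrence (y A B C D U V : ℂ) (m : ℕ)
    (h1 : ∀ k, risingFactorial (A + B) k ≠ 0) (h2 : ∀ k, risingFactorial (A + C) k ≠ 0)
    (h3 : ∀ k, risingFactorial (A + D) k ≠ 0) (hs0 : (m : ℂ) + A + B + C + D ≠ 0)
    (hs1 : 2 * (m : ℂ) + A + B + C + D ≠ 0) (hs2 : 2 * (m : ℂ) + 1 + A + B + C + D ≠ 0)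
    (hs3 : 2 * (m : ℂ) + 2 + A + B + C + D ≠ 0)
    (hU : U * ((2 * (m : ℂ) + 1 + A + B + C + D) * (2 * m + 2 + A + B + C + D)) =
      (m + A + B + C + D) * (m + 1 + A + B) * (m + 1 + A + C) * (m + 1 + A + D))
    (hV : V * ((2 * (m : ℂ) + A + B + C + D) * (2 * m + 1 + A + B + C + D)) =
      (m + 1) * (m + B + C) * (m + B + D) * (m + C + D)) :
    U * (wilson (m + 2) y A B C D - wilson (m + 1) y A B C D) +
      V * (wilson m y A B C D - wilson (m + 1) y A B C D) =
      -(A ^ 2 + y) * wilson (m + 1) y A B C D := by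
  set s := A + B + C + D - 1
  have key : ∀ k, U * (wilsonCoeff s (A + B) (A + C) (A + D) (m + 2) (k + 1) -
        wilsonCoeff s (A + B) (A + C) (A + D) (m + 1) (k + 1)) +
      V * (wilsonCoeff s (A + B) (A + C) (A + D) m (k + 1) -
        wilsonCoeff s (A + B) (A + C) (A + D) (m + 1) (k + 1)) -
      (k + 1) * (A + B + (A + C) + (A + D) - s + k) *
        wilsonCoeff s (A + B) (A + C) (A + D) (m + 1) (k + 1) =
      -wilsonCoeff s (A + B) (A + C) (A + D) (m + 1) k := fun k =>
    wilsonCoeff_recurrence s (A + B) (A + C) (A + D) U V m k (h1 _) (h2 _) (h3 _)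
      (by convert hs0 using 1; ring) (by convert hs1 using 1; ring)
      (by convert hs2 using 1; ring) (by convert hs3 using 1; ring)
      (by linear_combination hU) (by linear_combination hV)
  rw [wilson_eq_sum_range y A B C D (show m < m + 4 by omega),
    wilson_eq_sum_range y A B C D (show m + 1 < m + 4 by omega),
    wilson_eq_sum_range y A B C D (show m + 2 < m + 4 by omega)]
  set φ : ℕ → ℂ := fun k => ∏ l ∈ Finset.range k, ((A + (l : ℂ)) ^ 2 + y)
  have hφ (k : ℕ) : φ (k + 1) = φ k * ((A + k) ^ 2 + y) := Finset.prod_range_succ _ _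
  set c := wilsonCoeff s (A + B) (A + C) (A + D)
  -- The common range m+4 exceeds every degree; the vanishing top coefficient lets the sums be
  -- shifted by one index.
  have hl : c (m + 1) (m + 3) = 0 := wilsonCoeff_of_lt _ _ _ _ (by omega)
  have hz : ∀ n, c n 0 = 1 := wilsonCoeff_zero _ _ _ _
  have e1 : U * (∑ k ∈ Finset.range (m + 4), c (m + 2) k * φ k -
        ∑ k ∈ Finset.range (m + 4), c (m + 1) k * φ k) +
      V * (∑ k ∈ Finset.range (m + 4), c m k * φ k -
        ∑ k ∈ Finset.range (m + 4), c (m + 1) k * φ k) =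
      ∑ k ∈ Finset.range (m + 4), (U * (c (m + 2) k - c (m + 1) k) +
        V * (c m k - c (m + 1) k)) * φ k := by
    rw [← Finset.sum_sub_distrib, ← Finset.sum_sub_distrib, Finset.mul_sum, Finset.mul_sum,
      ← Finset.sum_add_distrib]
    exact Finset.sum_congr rfl fun k _ => by ring
  have e2 : ∑ k ∈ Finset.range (m + 4), c (m + 1) k * φ k =
      ∑ k ∈ Finset.range (m + 3), c (m + 1) k * φ k := by
    rw [Finset.sum_range_succ, hl, zero_mul, add_zero]
  have e3 : ∑ k ∈ Finset.range (m + 3), ((k : ℂ) * (2 * A + k)) * c (m + 1) k * φ k =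
      ∑ k ∈ Finset.range (m + 3), (((k + 1 : ℕ) : ℂ) * (2 * A + (k + 1 : ℕ))) *
        c (m + 1) (k + 1) * φ (k + 1) := by
    have h := Finset.sum_range_succ'
      (fun k : ℕ => ((k : ℂ) * (2 * A + k)) * c (m + 1) k * φ k) (m + 3)
    rw [Finset.sum_range_succ, hl] at h
    simpa using h
  change U * (∑ k ∈ Finset.range (m + 4), c (m + 2) k * φ k -
        ∑ k ∈ Finset.range (m + 4), c (m + 1) k * φ k) +
      V * (∑ k ∈ Finset.range (m + 4), c m k * φ k -
        ∑ k ∈ Finset.range (m + 4), c (m + 1) k * φ k) =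
    -(A ^ 2 + y) * ∑ k ∈ Finset.range (m + 4), c (m + 1) k * φ k
  rw [e1, e2, Finset.sum_range_succ', hz, hz, hz]
  have e4 : ∑ k ∈ Finset.range (m + 3), (U * (c (m + 2) (k + 1) - c (m + 1) (k + 1)) +
        V * (c m (k + 1) - c (m + 1) (k + 1))) * φ (k + 1) =
      ∑ k ∈ Finset.range (m + 3), (((k + 1 : ℕ) : ℂ) * (2 * A + (k + 1 : ℕ))) *
        c (m + 1) (k + 1) * φ (k + 1) -
      ∑ k ∈ Finset.range (m + 3), c (m + 1) k * φ k * ((A + k) ^ 2 + y) := by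
    rw [← Finset.sum_sub_distrib]
    refine Finset.sum_congr rfl fun k _ => ?_
    have hk := key k
    rw [hφ]
    simp only [s] at hk
    push_cast
    linear_combination φ k * ((A + k) ^ 2 + y) * hk
  rw [e4, ← e3, ← Finset.sum_sub_distrib, Finset.mul_sum]
  simp only [sub_self, mul_zero, add_zero, zero_mul]
  exact Finset.sum_congr rfl fun k _ => by ring

end Wilson

/-! ### Specialisation of the Wilson parameters; closed forms of the coefficients. -/

section JacobiWilson

variable {a b : ℝ}

lemma risingFactorial_ofReal_ne_zero {x : ℝ} (hx : 0 < x) {z : ℂ} (h : z = (x : ℂ)) (k : ℕ) :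
    risingFactorial z k ≠ 0 := by
  have := map_risingFactorial Complex.ofRealHom x k
  rw [Complex.ofRealHom_eq_coe, Complex.ofRealHom_eq_coe, ← h] at this
  rw [← this]
  exact Complex.ofReal_ne_zero.2 (risingFactorial_pos fun _ => hx).ne'

lemma risingFactorial_wilson_params_ne_zero (ha : -1 < a) (hb : -1 < b) (k : ℕ) :
    risingFactorial (((a : ℂ) + 1) / 2 + ((b : ℂ) + 1) / 2) k ≠ 0 ∧
    risingFactorial (((a : ℂ) + 1) / 2 + 1 / 2) k ≠ 0 ∧
    risingFactorial (((a : ℂ) + 1) / 2 + 0) k ≠ 0 :=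
  ⟨risingFactorial_ofReal_ne_zero (x := (a + b + 2) / 2) (by linarith) (by push_cast; ring) k,
   risingFactorial_ofReal_ne_zero (x := (a + 2) / 2) (by linarith) (by push_cast; ring) k,
   risingFactorial_ofReal_ne_zero (x := (a + 1) / 2) (by linarith) (by push_cast; ring) k⟩

/-- The coefficient of `W_{m+2}` in the recurrence of `W_{m+1} = jacobiWilson a b X (m + 1)`. -/
noncomputable def jacobiWilsonUp (a b : ℝ) (m : ℕ) : ℝ :=
  (2 * m + a + b + 3) * (2 * m + a + b + 4) * (2 * m + a + 3) * (2 * m + a + 4) /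
    ((4 * m + a + b + 5) * (4 * m + a + b + 7))

/-- The coefficient of `W_m` in the recurrence of `W_{m+1} = jacobiWilson a b X (m + 1)`. -/
noncomputable def jacobiWilsonDown (a b : ℝ) (m : ℕ) : ℝ :=
  (2 * m + 1) * (2 * m + 2) * (2 * m + b + 1) * (2 * m + b + 2) /
    ((4 * m + a + b + 3) * (4 * m + a + b + 5))

lemma jacobiWilson_recurrence (ha : -1 < a) (hb : -1 < b) (X : ℂ) (m : ℕ) :
    (jacobiWilsonUp a b m : ℂ) * jacobiWilson a b X (m + 2) -
      (X ^ 2 + (jacobiWilsonUp a b m + jacobiWilsonDown a b m - (a + 1) ^ 2 : ℝ)) *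
        jacobiWilson a b X (m + 1) +
      (jacobiWilsonDown a b m : ℂ) * jacobiWilson a b X m = 0 := by
  have hm : (0 : ℝ) ≤ m := m.cast_nonneg
  have hne {x : ℝ} (hx : 0 < x) {z : ℂ} (h : z = (x : ℂ)) : z ≠ 0 := by
    rw [h]; exact Complex.ofReal_ne_zero.2 hx.ne'
  have h3 : 4 * (m : ℂ) + a + b + 3 ≠ 0 :=
    hne (x := 4 * m + a + b + 3) (by linarith) (by push_cast; ring)
  have h5 : 4 * (m : ℂ) + a + b + 5 ≠ 0 :=
    hne (x := 4 * m + a + b + 5) (by linarith) (by push_cast; ring)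
  have h7 : 4 * (m : ℂ) + a + b + 7 ≠ 0 :=
    hne (x := 4 * m + a + b + 7) (by linarith) (by push_cast; ring)
  have hr := risingFactorial_wilson_params_ne_zero ha hb
  have hU : (jacobiWilsonUp a b m : ℂ) * ((4 * (m : ℂ) + a + b + 5) * (4 * m + a + b + 7)) =
      (2 * m + a + b + 3) * (2 * m + a + b + 4) * (2 * m + a + 3) * (2 * m + a + 4) := by
    rw [jacobiWilsonUp]; push_cast; exact div_mul_cancel₀ _ (mul_ne_zero h5 h7)
  have hV : (jacobiWilsonDown a b m : ℂ) * ((4 * (m : ℂ) + a + b + 3) * (4 * m + a + b + 5)) =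
      (2 * m + 1) * (2 * m + 2) * (2 * m + b + 1) * (2 * m + b + 2) := by
    rw [jacobiWilsonDown]; push_cast; exact div_mul_cancel₀ _ (mul_ne_zero h3 h5)
  have h := wilson_recurrence (-X ^ 2 / 4) (((a : ℂ) + 1) / 2) (((b : ℂ) + 1) / 2) (1 / 2) 0
    (jacobiWilsonUp a b m / 4) (jacobiWilsonDown a b m / 4) m
    (fun k => (hr k).1) (fun k => (hr k).2.1) (fun k => (hr k).2.2)
    (hne (x := m + (a + b + 3) / 2) (by linarith) (by push_cast; ring))
    (hne (x := 2 * m + (a + b + 3) / 2) (by linarith) (by push_cast; ring))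
    (hne (x := 2 * m + (a + b + 5) / 2) (by linarith) (by push_cast; ring))
    (hne (x := 2 * m + (a + b + 7) / 2) (by linarith) (by push_cast; ring))
    (by linear_combination hU / 16) (by linear_combination hV / 16)
  simp only [jacobiWilson]
  push_cast
  linear_combination 4 * h

@[simp] lemma jacobiWilson_zero (a b : ℝ) (X : ℂ) : jacobiWilson a b X 0 = 1 := by
  simp [jacobiWilson, wilson]

/-- The step from degree 0 to degree 1 is computed directly: the general coefficient would contain
(a+b+1)/(a+b+1), and a+b+1 may vanish. -/
lemma jacobiWilson_one (ha : -1 < a) (hb : -1 < b) (X : ℂ) :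
    ((a + b + 2 : ℝ) : ℂ) * ((a + 1 : ℝ) : ℂ) * ((a + 2 : ℝ) : ℂ) * jacobiWilson a b X 1 =
      ((a + b + 3 : ℝ) : ℂ) * X ^ 2 + ((a + 1 : ℝ) : ℂ) * ((b + 1 : ℝ) : ℂ) := by
  have hr := risingFactorial_wilson_params_ne_zero ha hb 1
  simp only [risingFactorial_one] at hr
  obtain ⟨h1, h2, h3⟩ := hr
  have hD := mul_ne_zero (mul_ne_zero h1 h2) h3
  have hW : jacobiWilson a b X 1 = 1 +
      -(((a : ℂ) + b + 3) / 2) * (((a : ℂ) + 1) ^ 2 / 4 + -X ^ 2 / 4) /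
        ((((a : ℂ) + 1) / 2 + ((b : ℂ) + 1) / 2) * (((a : ℂ) + 1) / 2 + 1 / 2) *
          (((a : ℂ) + 1) / 2 + 0)) := by
    simp only [jacobiWilson, wilson, Finset.sum_range_succ, Finset.sum_range_zero,
      Finset.prod_range_succ, Finset.prod_range_zero, risingFactorial_one, risingFactorial_zero,
      Nat.factorial]
    push_cast
    ring
  have hc := mul_div_cancel₀ (-(((a : ℂ) + b + 3) / 2) * (((a : ℂ) + 1) ^ 2 / 4 + -X ^ 2 / 4)) hD
  rw [hW]
  push_cast
  linear_combination 8 * hc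

/-- The Gamma factor in `jacobiAlpha`. -/
noncomputable def jacobiAlphaFactor (a b : ℝ) (j : ℕ) : ℝ :=
  ((2 : ℝ) ^ (2 * j))⁻¹ * Real.Gamma (4 * j + a + b + 2) /
    (((2 * j).factorial : ℝ) * Real.Gamma (2 * j + b + 1))

lemma jacobiAlpha_eq (a b : ℝ) (X : ℂ) (j : ℕ) :
    jacobiAlpha a b X j = (jacobiAlphaFactor a b j : ℂ) * jacobiWilson a b X j := rfl

lemma jacobiAlphaFactor_pos (ha : -1 < a) (hb : -1 < b) (j : ℕ) : 0 < jacobiAlphaFactor a b j := by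
  have hj : (0 : ℝ) ≤ j := j.cast_nonneg
  have h1 : 0 < Real.Gamma (4 * j + a + b + 2) := Real.Gamma_pos_of_pos (by linarith)
  have h2 : 0 < Real.Gamma (2 * j + b + 1) := Real.Gamma_pos_of_pos (by linarith)
  have h3 : (0 : ℝ) < (2 * j).factorial := by exact_mod_cast (2 * j).factorial_pos
  unfold jacobiAlphaFactor
  positivity

lemma jacobiAlphaFactor_succ (ha : -1 < a) (hb : -1 < b) (j : ℕ) :
    jacobiAlphaFactor a b (j + 1) * (4 * (2 * j + 1) * (2 * j + 2) * (2 * j + b + 1) *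
      (2 * j + b + 2)) = jacobiAlphaFactor a b j * ((4 * j + a + b + 2) * (4 * j + a + b + 3) *
      (4 * j + a + b + 4) * (4 * j + a + b + 5)) := by
  have hj : (0 : ℝ) ≤ j := j.cast_nonneg
  have g (x y : ℝ) (hx : 0 < x) (h : y = x + 1) : Real.Gamma y = x * Real.Gamma x := by
    rw [h, Real.Gamma_add_one hx.ne']
  have e1 : 2 * (j + 1) = 2 * j + 1 + 1 := by ring
  rw [jacobiAlphaFactor, jacobiAlphaFactor, e1, Nat.factorial_succ, Nat.factorial_succ, pow_succ,
    pow_succ]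
  push_cast
  rw [g (4 * j + a + b + 5) (4 * (j + 1) + a + b + 2) (by linarith) (by ring),
    g (4 * j + a + b + 4) (4 * j + a + b + 5) (by linarith) (by ring),
    g (4 * j + a + b + 3) (4 * j + a + b + 4) (by linarith) (by ring),
    g (4 * j + a + b + 2) (4 * j + a + b + 3) (by linarith) (by ring),
    g (2 * j + b + 2) (2 * (j + 1) + b + 1) (by linarith) (by ring),
    g (2 * j + b + 1) (2 * j + b + 2) (by linarith) (by ring)]
  have h1 := (Real.Gamma_pos_of_pos (show 0 < 2 * (j : ℝ) + b + 1 by linarith)).ne'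
  have h2 : 2 * (j : ℝ) + b + 1 ≠ 0 := by linarith
  have h3 : 2 * (j : ℝ) + b + 2 ≠ 0 := by linarith
  have h4 : ((2 * j).factorial : ℝ) ≠ 0 := by exact_mod_cast (2 * j).factorial_ne_zero
  field_simp
  ring

lemma jacobiNormFour_odd_eq (ha : -1 < a) (hb : -1 < b) (m : ℕ) :
    jacobiNormFour a b (2 * m + 1) =
      (4 * m + a + b + 4) * (4 * m + a + b + 6) / 4 * jacobiNormOne a b (m + 1) := by
  have h := (jacobiSkewCoeff_pos ha hb (2 * (m + 1))).ne'
  have e1 : (4 * m + a + b + 4 : ℝ) = 2 * jacobiSkewCoeff a b (2 * m + 1) := by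
    rw [jacobiSkewCoeff]; push_cast; ring
  have e2 : (4 * m + a + b + 6 : ℝ) = 2 * jacobiSkewCoeff a b (2 * (m + 1)) := by
    rw [jacobiSkewCoeff]; push_cast; ring
  rw [jacobiNormFour_eq ha hb, jacobiNormOne_eq ha hb, e1, e2]
  field_simp
  ring_nf

lemma jacobiZeta_mul_jacobiNormFour_even (ha : -1 < a) (hb : -1 < b) (m : ℕ) :
    jacobiZeta a b (m + 1) * jacobiNormFour a b (2 * m) =
      (4 * m + a + b + 2) * (4 * m + a + b + 4) / 4 * jacobiNormOne a b (m + 1) := by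
  have hm : (0 : ℝ) ≤ m := m.cast_nonneg
  have h6 : 4 * (m : ℝ) + a + b + 6 ≠ 0 := by linarith
  have h := jacobiZeta_mul_jacobiNormFour ha hb m
  rw [jacobiNormFour_odd_eq ha hb] at h
  refine mul_right_cancel₀ h6 (h.trans ?_)
  ring

lemma jacobiNormFour_even_eq (ha : -1 < a) (hb : -1 < b) (m : ℕ) :
    jacobiNormFour a b (2 * m + 2) =
      (2 * m + 3) * (2 * m + a + 3) * (2 * m + b + 3) * (2 * m + a + b + 3) /
        ((4 * m + a + b + 5) * (4 * m + a + b + 7)) * jacobiNormOne a b (m + 1) := by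
  have hm : (0 : ℝ) ≤ m := m.cast_nonneg
  have h4 : 4 * (m : ℝ) + a + b + 4 ≠ 0 := by linarith
  have h5 : 4 * (m : ℝ) + a + b + 5 ≠ 0 := by linarith
  have h6 : 4 * (m : ℝ) + a + b + 6 ≠ 0 := by linarith
  have h7 : 4 * (m : ℝ) + a + b + 7 ≠ 0 := by linarith
  rw [jacobiNormFour_succ ha hb, jacobiNormFour_odd_eq ha hb]
  push_cast
  rw [show 2 * (2 * (m : ℝ) + 1) + a + b + 2 = 4 * m + a + b + 4 by ring,
    show 2 * (2 * (m : ℝ) + 1) + a + b + 3 = 4 * m + a + b + 5 by ring,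
    show 2 * (2 * (m : ℝ) + 1) + a + b + 4 = 4 * m + a + b + 6 by ring,
    show 2 * (2 * (m : ℝ) + 1) + a + b + 5 = 4 * m + a + b + 7 by ring,
    show 2 * (m : ℝ) + 1 + 2 = 2 * m + 3 by ring,
    show 2 * (m : ℝ) + 1 + a + 2 = 2 * m + a + 3 by ring,
    show 2 * (m : ℝ) + 1 + b + 2 = 2 * m + b + 3 by ring,
    show 2 * (m : ℝ) + 1 + a + b + 2 = 2 * m + a + b + 3 by ring]
  generalize 4 * (m : ℝ) + a + b + 4 = s4 at *
  generalize 4 * (m : ℝ) + a + b + 5 = s5 at *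
  generalize 4 * (m : ℝ) + a + b + 6 = s6 at *
  generalize 4 * (m : ℝ) + a + b + 7 = s7 at *
  field_simp

lemma jacobiZeta_mul_jacobiNormFour_odd (ha : -1 < a) (hb : -1 < b) (m : ℕ) :
    jacobiZeta a b (m + 1) * jacobiNormFour a b (2 * m + 1) =
      (2 * m + 2) * (2 * m + a + 2) * (2 * m + b + 2) * (2 * m + a + b + 2) /
        ((4 * m + a + b + 3) * (4 * m + a + b + 5)) * jacobiNormOne a b (m + 1) := by
  have hm : (0 : ℝ) ≤ m := m.cast_nonneg
  have h3 : 4 * (m : ℝ) + a + b + 3 ≠ 0 := by linarith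
  have h4 : 4 * (m : ℝ) + a + b + 4 ≠ 0 := by linarith
  have h5 : 4 * (m : ℝ) + a + b + 5 ≠ 0 := by linarith
  have h6 : 4 * (m : ℝ) + a + b + 6 ≠ 0 := by linarith
  rw [jacobiZeta_succ, jacobiNormFour_odd_eq ha hb]
  generalize 4 * (m : ℝ) + a + b + 3 = s3 at *
  generalize 4 * (m : ℝ) + a + b + 4 = s4 at *
  generalize 4 * (m : ℝ) + a + b + 5 = s5 at *
  generalize 4 * (m : ℝ) + a + b + 6 = s6 at *
  field_simp
  ring

/-- This lemma and the next two match the upper, lower and diagonal coefficients of the even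
recurrence with those of the Wilson recurrence, all multiplied by h⁽¹⁾_{m+1} times the Gamma factor
of α_{m+1}. -/
lemma jacobiNormFour_mul_jacobiAlphaFactor (ha : -1 < a) (hb : -1 < b) (m : ℕ) :
    jacobiNormFour a b (2 * m + 3) * jacobiAlphaFactor a b (m + 2) =
      jacobiNormOne a b (m + 1) * jacobiAlphaFactor a b (m + 1) * jacobiWilsonUp a b m := by
  have hm : (0 : ℝ) ≤ m := m.cast_nonneg
  have h5 : 4 * (m : ℝ) + a + b + 5 ≠ 0 := by linarith
  have h6 : 4 * (m : ℝ) + a + b + 6 ≠ 0 := by linarith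
  have h7 : 4 * (m : ℝ) + a + b + 7 ≠ 0 := by linarith
  have h8 : 4 * (m : ℝ) + a + b + 8 ≠ 0 := by linarith
  have h9 : 4 * (m : ℝ) + a + b + 9 ≠ 0 := by linarith
  have k1 : 2 * (m : ℝ) + 3 ≠ 0 := by linarith
  have k2 : 2 * (m : ℝ) + 4 ≠ 0 := by linarith
  have k3 : 2 * (m : ℝ) + b + 3 ≠ 0 := by linarith
  have k4 : 2 * (m : ℝ) + b + 4 ≠ 0 := by linarith
  have hg := jacobiAlphaFactor_succ ha hb (m + 1)
  push_cast at hg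
  rw [show 2 * ((m : ℝ) + 1) + 1 = 2 * m + 3 by ring,
    show 2 * ((m : ℝ) + 1) + 2 = 2 * m + 4 by ring,
    show 2 * ((m : ℝ) + 1) + b + 1 = 2 * m + b + 3 by ring,
    show 2 * ((m : ℝ) + 1) + b + 2 = 2 * m + b + 4 by ring,
    show 4 * ((m : ℝ) + 1) + a + b + 2 = 4 * m + a + b + 6 by ring,
    show 4 * ((m : ℝ) + 1) + a + b + 3 = 4 * m + a + b + 7 by ring,
    show 4 * ((m : ℝ) + 1) + a + b + 4 = 4 * m + a + b + 8 by ring,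
    show 4 * ((m : ℝ) + 1) + a + b + 5 = 4 * m + a + b + 9 by ring] at hg
  have hg' := eq_div_of_mul_eq (by positivity) hg
  rw [hg', jacobiNormFour_succ ha hb, jacobiNormFour_even_eq ha hb, jacobiWilsonUp]
  push_cast
  rw [show 2 * (2 * (m : ℝ) + 2) + a + b + 2 = 4 * m + a + b + 6 by ring,
    show 2 * (2 * (m : ℝ) + 2) + a + b + 3 = 4 * m + a + b + 7 by ring,
    show 2 * (2 * (m : ℝ) + 2) + a + b + 4 = 4 * m + a + b + 8 by ring,
    show 2 * (2 * (m : ℝ) + 2) + a + b + 5 = 4 * m + a + b + 9 by ring,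
    show 2 * (m : ℝ) + 2 + 2 = 2 * m + 4 by ring,
    show 2 * (m : ℝ) + 2 + a + 2 = 2 * m + a + 4 by ring,
    show 2 * (m : ℝ) + 2 + b + 2 = 2 * m + b + 4 by ring,
    show 2 * (m : ℝ) + 2 + a + b + 2 = 2 * m + a + b + 4 by ring]
  generalize 4 * (m : ℝ) + a + b + 5 = s5 at *
  generalize 4 * (m : ℝ) + a + b + 6 = s6 at *
  generalize 4 * (m : ℝ) + a + b + 7 = s7 at *
  generalize 4 * (m : ℝ) + a + b + 8 = s8 at *
  generalize 4 * (m : ℝ) + a + b + 9 = s9 at *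
  generalize 2 * (m : ℝ) + 3 = t1 at *
  generalize 2 * (m : ℝ) + 4 = t2 at *
  generalize 2 * (m : ℝ) + b + 3 = t3 at *
  generalize 2 * (m : ℝ) + b + 4 = t4 at *
  field_simp

lemma jacobiZeta_mul_jacobiAlphaFactor (ha : -1 < a) (hb : -1 < b) (m : ℕ) :
    jacobiZeta a b (m + 1) * jacobiNormFour a b (2 * m) * jacobiAlphaFactor a b m =
      jacobiNormOne a b (m + 1) * jacobiAlphaFactor a b (m + 1) * jacobiWilsonDown a b m := by
  have hm : (0 : ℝ) ≤ m := m.cast_nonneg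
  have h2 : 4 * (m : ℝ) + a + b + 2 ≠ 0 := by linarith
  have h3 : 4 * (m : ℝ) + a + b + 3 ≠ 0 := by linarith
  have h4 : 4 * (m : ℝ) + a + b + 4 ≠ 0 := by linarith
  have h5 : 4 * (m : ℝ) + a + b + 5 ≠ 0 := by linarith
  have hg := eq_div_of_mul_eq (by positivity) (jacobiAlphaFactor_succ ha hb m).symm
  rw [hg, jacobiZeta_mul_jacobiNormFour_even ha hb, jacobiWilsonDown]
  generalize 4 * (m : ℝ) + a + b + 2 = s2 at *
  generalize 4 * (m : ℝ) + a + b + 3 = s3 at *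
  generalize 4 * (m : ℝ) + a + b + 4 = s4 at *
  generalize 4 * (m : ℝ) + a + b + 5 = s5 at *
  field_simp

lemma jacobiNorm_diagonal (ha : -1 < a) (hb : -1 < b) (m : ℕ) :
    jacobiNormFour a b (2 * m + 2) + jacobiZeta a b (m + 1) * jacobiNormFour a b (2 * m + 1) =
      jacobiNormOne a b (m + 1) *
        (jacobiWilsonUp a b m + jacobiWilsonDown a b m - (a + 1) ^ 2) := by
  have hm : (0 : ℝ) ≤ m := m.cast_nonneg
  have h3 : 4 * (m : ℝ) + a + b + 3 ≠ 0 := by linarith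
  have h5 : 4 * (m : ℝ) + a + b + 5 ≠ 0 := by linarith
  have h7 : 4 * (m : ℝ) + a + b + 7 ≠ 0 := by linarith
  rw [jacobiNormFour_even_eq ha hb, jacobiZeta_mul_jacobiNormFour_odd ha hb, jacobiWilsonUp,
    jacobiWilsonDown]
  -- The names keep the defining equations: after clearing denominators, a genuine polynomial
  -- identity in m, a, b remains.
  generalize hs3 : 4 * (m : ℝ) + a + b + 3 = s3 at *
  generalize hs5 : 4 * (m : ℝ) + a + b + 5 = s5 at *
  generalize hs7 : 4 * (m : ℝ) + a + b + 7 = s7 at *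
  field_simp
  rw [← hs3, ← hs5, ← hs7]
  ring

lemma jacobiNormOne_zero (a b : ℝ) : jacobiNormOne a b 0 =
    2 ^ (a + b + 2) * (Real.Gamma (a + 1) * Real.Gamma (b + 1)) / Real.Gamma (a + b + 3) := by
  simp [jacobiNormOne]

lemma jacobiNormFour_zero (ha : -1 < a) (hb : -1 < b) :
    (a + b + 3) * jacobiNormFour a b 0 = (a + 1) * (b + 1) * jacobiNormOne a b 0 := by
  have g (x y : ℝ) (hx : 0 < x) (h : y = x + 1) : Real.Gamma y = x * Real.Gamma x := by
    rw [h, Real.Gamma_add_one hx.ne']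
  have h1 := (Real.Gamma_pos_of_pos (show 0 < a + b + 2 by linarith)).ne'
  have h2 := (Real.Gamma_pos_of_pos (show 0 < a + b + 3 by linarith)).ne'
  have h3 : a + b + 3 ≠ 0 := by linarith
  rw [jacobiNormOne_zero, jacobiNormFour]
  simp only [Nat.cast_zero, mul_zero, zero_add, add_zero]
  rw [g (a + 1) (a + 2) (by linarith) (by ring), g (b + 1) (b + 2) (by linarith) (by ring),
    g (a + b + 3) (a + b + 4) (by linarith) (by ring), Real.Gamma_two]
  field_simp

lemma jacobiNormFour_one_mul_jacobiAlphaFactor (ha : -1 < a) (hb : -1 < b) :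
    (a + b + 3) * (jacobiNormFour a b 1 * jacobiAlphaFactor a b 1) =
      jacobiNormOne a b 0 * jacobiAlphaFactor a b 0 * ((a + b + 2) * (a + 1) * (a + 2)) := by
  have h2 : a + b + 2 ≠ 0 := by linarith
  have h3 : a + b + 3 ≠ 0 := by linarith
  have h4 : a + b + 4 ≠ 0 := by linarith
  have h5 : a + b + 5 ≠ 0 := by linarith
  have k1 : b + 1 ≠ 0 := by linarith
  have k2 : b + 2 ≠ 0 := by linarith
  have hg := jacobiAlphaFactor_succ ha hb 0
  have hs := jacobiNormFour_succ ha hb 0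
  have h0 := eq_div_of_mul_eq h3 ((mul_comm _ _).trans (jacobiNormFour_zero ha hb))
  simp only [Nat.cast_zero, mul_zero, zero_add] at hg hs
  have hg' := eq_div_of_mul_eq (by positivity) hg
  rw [hg', hs, h0]
  generalize a + b + 2 = s2 at *
  generalize a + b + 3 = s3 at *
  generalize a + b + 4 = s4 at *
  generalize a + b + 5 = s5 at *
  field_simp

lemma evenRecurrence_jacobiAlpha (ha : -1 < a) (hb : -1 < b) (X : ℂ) :
    EvenRecurrence a b X (jacobiAlpha a b X) := by
  refine ⟨?_, fun j => ?_⟩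
  · have h1 := congrArg (fun x : ℝ => (x : ℂ)) (jacobiNormFour_one_mul_jacobiAlphaFactor ha hb)
    have h2 := congrArg (fun x : ℝ => (x : ℂ)) (jacobiNormFour_zero ha hb)
    have h3 := jacobiWilson_one ha hb X
    have h4 : (a : ℂ) + b + 3 ≠ 0 := by
      have := Complex.ofReal_ne_zero.2 (show a + b + 3 ≠ 0 by linarith)
      push_cast at this
      exact this
    simp only [jacobiAlpha_eq, jacobiWilson_zero]
    push_cast at h1 h2 h3
    refine mul_left_cancel₀ h4 ?_
    linear_combination jacobiWilson a b X 1 * h1 - jacobiAlphaFactor a b 0 * h2 +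
      jacobiNormOne a b 0 * jacobiAlphaFactor a b 0 * h3
  · have h1 := congrArg (fun x : ℝ => (x : ℂ)) (jacobiNormFour_mul_jacobiAlphaFactor ha hb j)
    have h2 := congrArg (fun x : ℝ => (x : ℂ)) (jacobiZeta_mul_jacobiAlphaFactor ha hb j)
    have h3 := congrArg (fun x : ℝ => (x : ℂ)) (jacobiNorm_diagonal ha hb j)
    have h4 := jacobiWilson_recurrence ha hb X j
    simp only [jacobiAlpha_eq]
    push_cast at h1 h2 h3 h4
    linear_combination jacobiWilson a b X (j + 2) * h1 + jacobiWilson a b X j * h2 -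
      jacobiAlphaFactor a b (j + 1) * jacobiWilson a b X (j + 1) * h3 +
      jacobiNormOne a b (j + 1) * jacobiAlphaFactor a b (j + 1) * h4

lemma oddRecurrence_jacobiXi (ha : -1 < a) (hb : -1 < b) (X : ℂ) :
    OddRecurrence a b X (jacobiXi a b X) := by
  obtain ⟨h0, h1⟩ := evenRecurrence_jacobiAlpha ha hb X
  have h2 : (a : ℂ) + b + 2 ≠ 0 := by
    have := Complex.ofReal_ne_zero.2 (show a + b + 2 ≠ 0 by linarith)
    push_cast at this
    exact this
  have hz (n : ℕ) := congrArg (fun x : ℝ => (x : ℂ)) (jacobiZeta_mul_jacobiNormFour ha hb n)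
  refine ⟨?_, fun j => ?_⟩
  · have z0 := hz 0
    simp only [jacobiXi]
    push_cast at z0 ⊢
    simp only [mul_zero, zero_add] at z0 ⊢
    field_simp
    linear_combination ((a : ℂ) + b + 2) * h0 + jacobiAlpha a b X 1 * z0
  · have z0 := hz j
    have z1 := hz (j + 1)
    rw [show 2 * (j + 1) = 2 * j + 2 by ring, show 2 * j + 2 + 1 = 2 * j + 3 by ring,
      show j + 1 + 1 = j + 2 by ring] at z1
    simp only [jacobiXi]
    push_cast at z0 z1 ⊢
    field_simp
    -- The even recurrence times 4j+a+b+6, with the outer coefficients exchanged by the ζ identity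
    -- at j and j+1.
    linear_combination (4 * (j : ℂ) + a + b + 6) * h1 j + jacobiAlpha a b X (j + 2) * z1 -
      jacobiAlpha a b X j * z0

lemma eq_of_threeTerm {c d e A B : ℕ → ℂ} (hc : ∀ j, c j ≠ 0) (h0 : A 0 = B 0)
    (hA0 : c 0 * A 1 - d 0 * A 0 = 0)
    (hA : ∀ j, c (j + 1) * A (j + 2) - d (j + 1) * A (j + 1) + e j * A j = 0)
    (hB0 : c 0 * B 1 - d 0 * B 0 = 0)
    (hB : ∀ j, c (j + 1) * B (j + 2) - d (j + 1) * B (j + 1) + e j * B j = 0) (j : ℕ) :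
    A j = B j := by
  suffices h : A j = B j ∧ A (j + 1) = B (j + 1) from h.1
  induction j with
  | zero =>
    refine ⟨h0, mul_left_cancel₀ (hc 0) ?_⟩
    rw [h0] at hA0
    linear_combination hA0 - hB0
  | succ j ih =>
    obtain ⟨h1, h2⟩ := ih
    refine ⟨h2, mul_left_cancel₀ (hc (j + 1)) ?_⟩
    have := hA j
    rw [h1, h2] at this
    linear_combination this - hB j

lemma jacobiAlpha_zero (a b : ℝ) (X : ℂ) :
    jacobiAlpha a b X 0 = ((Real.Gamma (a + b + 2) / Real.Gamma (b + 1) : ℝ) : ℂ) := by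
  rw [jacobiAlpha_eq, jacobiAlphaFactor]
  simp

lemma jacobiXi_zero (ha : -1 < a) (hb : -1 < b) (X : ℂ) :
    jacobiXi a b X 0 = jacobiAlpha a b X 0 := by
  have h2 : (a : ℂ) + b + 2 ≠ 0 := by
    have := Complex.ofReal_ne_zero.2 (show a + b + 2 ≠ 0 by linarith)
    push_cast at this
    exact this
  rw [jacobiXi]
  simp [h2]

lemma jacobiAlpha_zero_ne_zero (ha : -1 < a) (hb : -1 < b) (X : ℂ) :
    jacobiAlpha a b X 0 ≠ 0 := by
  rw [jacobiAlpha_eq, jacobiWilson_zero, mul_one]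
  exact Complex.ofReal_ne_zero.2 (jacobiAlphaFactor_pos ha hb 0).ne'

lemma evenRecurrence_div {X : ℂ} {A : ℕ → ℂ} (h : EvenRecurrence a b X A) (r : ℂ) :
    EvenRecurrence a b X fun j => A j / r :=
  ⟨by linear_combination h.1 / r, fun j => by linear_combination h.2 j / r⟩

lemma oddRecurrence_div {X : ℂ} {A : ℕ → ℂ} (h : OddRecurrence a b X A) (r : ℂ) :
    OddRecurrence a b X fun j => A j / r :=
  ⟨by linear_combination h.1 / r, fun j => by linear_combination h.2 j / r⟩

lemma EvenRecurrence.eq_of_zero_eq (ha : -1 < a) (hb : -1 < b) {X : ℂ} {A B : ℕ → ℂ}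
    (hA : EvenRecurrence a b X A) (hB : EvenRecurrence a b X B) (h : A 0 = B 0) (j : ℕ) :
    A j = B j := by
  refine eq_of_threeTerm (c := fun j => (jacobiNormFour a b (2 * j + 1) : ℂ))
    -- At j = 0 the truncated index 2j-1 is 0 instead of -1; harmless, as ζ_0 = 0.
    (d := fun j => X ^ 2 * jacobiNormOne a b j + jacobiNormFour a b (2 * j) +
      jacobiZeta a b j * jacobiNormFour a b (2 * j - 1))
    (e := fun j => jacobiZeta a b (j + 1) * jacobiNormFour a b (2 * j))
    (fun j => Complex.ofReal_ne_zero.2 (jacobiNormFour_pos ha hb _).ne') h ?_ hA.2 ?_ hB.2 j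
  · simpa [jacobiZeta] using hA.1
  · simpa [jacobiZeta] using hB.1

lemma OddRecurrence.eq_of_zero_eq (ha : -1 < a) (hb : -1 < b) {X : ℂ} {A B : ℕ → ℂ}
    (hA : OddRecurrence a b X A) (hB : OddRecurrence a b X B) (h : A 0 = B 0) (j : ℕ) :
    A j = B j := by
  refine eq_of_threeTerm (c := fun j => jacobiZeta a b (j + 1) * jacobiNormFour a b (2 * j))
    (d := fun j => X ^ 2 * jacobiNormOne a b j + jacobiNormFour a b (2 * j) +
      jacobiZeta a b j * jacobiNormFour a b (2 * j - 1))
    (e := fun j => (jacobiNormFour a b (2 * j + 1) : ℂ))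
    (fun j => mul_ne_zero (Complex.ofReal_ne_zero.2 (jacobiZeta_pos ha hb _).ne')
      (Complex.ofReal_ne_zero.2 (jacobiNormFour_pos ha hb _).ne')) h ?_ hA.2 ?_ hB.2 j
  · simpa [jacobiZeta] using hA.1
  · simpa [jacobiZeta] using hB.1

lemma evenRecurrence_iff (ha : -1 < a) (hb : -1 < b) (X : ℂ) (A : ℕ → ℂ) :
    (A 0 = 1 ∧ EvenRecurrence a b X A) ↔
      ∀ j, A j = jacobiAlpha a b X j / jacobiAlpha a b X 0 := by
  have h := evenRecurrence_div (evenRecurrence_jacobiAlpha ha hb X) (jacobiAlpha a b X 0)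
  have h0 := div_self (jacobiAlpha_zero_ne_zero ha hb X)
  constructor
  · rintro ⟨hA0, hA⟩
    exact hA.eq_of_zero_eq ha hb h (by rw [hA0, h0])
  · intro hA
    obtain rfl : A = _ := funext hA
    exact ⟨h0, h⟩

lemma oddRecurrence_iff (ha : -1 < a) (hb : -1 < b) (X : ℂ) (A : ℕ → ℂ) :
    (A 0 = 1 ∧ OddRecurrence a b X A) ↔
      ∀ j, A j = jacobiXi a b X j / jacobiXi a b X 0 := by
  have h := oddRecurrence_div (oddRecurrence_jacobiXi ha hb X) (jacobiXi a b X 0)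
  have h0 : jacobiXi a b X 0 / jacobiXi a b X 0 = 1 := by
    rw [jacobiXi_zero ha hb]
    exact div_self (jacobiAlpha_zero_ne_zero ha hb X)
  constructor
  · rintro ⟨hA0, hA⟩
    exact hA.eq_of_zero_eq ha hb h (by rw [hA0, h0])
  · intro hA
    obtain rfl : A = _ := funext hA
    exact ⟨h0, h⟩

lemma jacobiXi_eq (ha : -1 < a) (hb : -1 < b) (X : ℂ) (j : ℕ) :
    jacobiXi a b X j =
      ((((2 : ℝ) ^ (2 * j))⁻¹ * Real.Gamma (4 * j + a + b + 3) /
        (((2 * j).factorial : ℝ) * Real.Gamma (2 * j + b + 1) * (a + b + 2)) : ℝ) : ℂ) *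
        jacobiWilson a b X j := by
  have hj : (0 : ℝ) ≤ j := j.cast_nonneg
  have h : Real.Gamma (4 * j + a + b + 3) =
      (4 * j + a + b + 2) * Real.Gamma (4 * j + a + b + 2) := by
    rw [← Real.Gamma_add_one (by linarith)]
    ring_nf
  rw [jacobiXi, jacobiAlpha_eq, jacobiAlphaFactor, h]
  push_cast
  generalize (a : ℂ) + b + 2 = s
  rw [← div_div _ _ s]
  ring

/-- A difference of squares: this is where y = -X²/4 yields the two numerator parameters (a+1∓X)/2.
-/
lemma prod_wilson_factor (a X : ℂ) (k : ℕ) :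
    ∏ l ∈ Finset.range k, (((a + 1) / 2 + (l : ℂ)) ^ 2 + -X ^ 2 / 4) =
      risingFactorial ((a + 1 - X) / 2) k * risingFactorial ((a + 1 + X) / 2) k := by
  rw [risingFactorial_eq_prod, risingFactorial_eq_prod, ← Finset.prod_mul_distrib]
  exact Finset.prod_congr rfl fun l _ => by ring

lemma jacobiWilson_eq_hypergeometric (a b : ℝ) (X : ℂ) (j : ℕ) :
    jacobiWilson a b X j =
      hypergeometric4F3 (-(j : ℂ)) (j + (a + b + 1) / 2) ((a + 1 - X) / 2) ((a + 1 + X) / 2)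
        ((a + 1) / 2) ((a + 2) / 2) ((a + b + 2) / 2) 1 := by
  rw [hypergeometric4F3, tsum_eq_sum (s := Finset.range (j + 1)), jacobiWilson, wilson]
  · refine Finset.sum_congr rfl fun k _ => ?_
    rw [prod_wilson_factor,
      show (j : ℂ) + ((a : ℂ) + 1) / 2 + ((b : ℂ) + 1) / 2 + 1 / 2 + 0 - 1 =
        j + (a + b + 1) / 2 by ring,
      show ((a : ℂ) + 1) / 2 + ((b : ℂ) + 1) / 2 = (a + b + 2) / 2 by ring,
      show ((a : ℂ) + 1) / 2 + 1 / 2 = (a + 2) / 2 by ring, add_zero, one_pow, mul_one, div_div]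
    congr 1 <;> ring
  · intro k hk
    rw [risingFactorial_neg_of_lt (by simpa using hk)]
    simp

/-- Put E_j = h⁽⁴⁾_{2j+1}α_{j+1} - h⁽⁴⁾_{2j}α_j. The recurrence reads E_{j+1} = x²h⁽¹⁾_{j+1}α_{j+1}
+ ζ_{j+1}E_j, so α_j > 0 and E_j ≥ 0 propagate together. -/
lemma jacobiAlpha_ne_zero_of_real (ha : -1 < a) (hb : -1 < b) (x : ℝ) (j : ℕ) :
    jacobiAlpha a b x j ≠ 0 := by
  obtain ⟨h0, h1⟩ := evenRecurrence_jacobiAlpha ha hb (x : ℂ)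
  have hx := sq_nonneg x
  suffices h : ∃ r t : ℝ, jacobiAlpha a b x j = r ∧ jacobiAlpha a b x (j + 1) = t ∧ 0 < r ∧
      0 ≤ jacobiNormFour a b (2 * j + 1) * t - jacobiNormFour a b (2 * j) * r by
    obtain ⟨r, _, hr, _, hpos, _⟩ := h
    rw [hr]
    exact Complex.ofReal_ne_zero.2 hpos.ne'
  induction j with
  | zero =>
    have hn := jacobiNormFour_pos ha hb 1
    have hn' : (jacobiNormFour a b 1 : ℂ) ≠ 0 := Complex.ofReal_ne_zero.2 hn.ne'
    refine ⟨jacobiAlphaFactor a b 0, (x ^ 2 * jacobiNormOne a b 0 + jacobiNormFour a b 0) *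
      jacobiAlphaFactor a b 0 / jacobiNormFour a b 1, by simp [jacobiAlpha_eq], ?_,
      jacobiAlphaFactor_pos ha hb 0, ?_⟩
    · rw [jacobiAlpha_eq a b x 0, jacobiWilson_zero, mul_one] at h0
      push_cast
      rw [eq_div_iff hn']
      linear_combination h0
    · have := mul_pos (jacobiNormOne_pos ha hb 0) (jacobiAlphaFactor_pos ha hb 0)
      simp only [mul_zero, zero_add]
      rw [mul_div_cancel₀ _ hn.ne']
      nlinarith
  | succ j ih =>
    obtain ⟨r, t, hr, ht, hpos, hD⟩ := ih
    have hn := jacobiNormFour_pos ha hb (2 * j + 3)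
    have hn' : (jacobiNormFour a b (2 * j + 3) : ℂ) ≠ 0 := Complex.ofReal_ne_zero.2 hn.ne'
    have htpos : 0 < t := by
      have h2 := mul_pos (jacobiNormFour_pos ha hb (2 * j)) hpos
      exact (pos_iff_pos_of_mul_pos (show 0 < jacobiNormFour a b (2 * j + 1) * t by linarith)).1
        (jacobiNormFour_pos ha hb _)
    refine ⟨t, ((x ^ 2 * jacobiNormOne a b (j + 1) + jacobiNormFour a b (2 * j + 2) +
        jacobiZeta a b (j + 1) * jacobiNormFour a b (2 * j + 1)) * t -
        jacobiZeta a b (j + 1) * jacobiNormFour a b (2 * j) * r) /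
        jacobiNormFour a b (2 * j + 3), ht, ?_, htpos, ?_⟩
    · have h2 := h1 j
      rw [hr, ht] at h2
      push_cast
      rw [eq_div_iff hn']
      linear_combination h2
    · have h3 := mul_nonneg hx (mul_pos (jacobiNormOne_pos ha hb (j + 1)) htpos).le
      have h4 := mul_nonneg (jacobiZeta_pos ha hb j).le hD
      rw [show 2 * (j + 1) + 1 = 2 * j + 3 by ring, show 2 * (j + 1) = 2 * j + 2 by ring,
        mul_div_cancel₀ _ hn.ne']
      linarith

end JacobiWilson

/-! ### Uniqueness of monic skew orthogonal families. -/

section SkewUniqueness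

open Polynomial

/-- The family with even members `E` and odd members `O`. -/
noncomputable def skewInterleave (E O : ℕ → ℂ[X]) (n : ℕ) : ℂ[X] :=
  if n % 2 = 0 then E (n / 2) else O (n / 2)

lemma skewInterleave_even (E O : ℕ → ℂ[X]) (m : ℕ) : skewInterleave E O (2 * m) = E m := by
  simp [skewInterleave]

lemma skewInterleave_odd (E O : ℕ → ℂ[X]) (m : ℕ) : skewInterleave E O (2 * m + 1) = O m := by
  rw [skewInterleave, if_neg (by omega)]
  congr 1
  omega

lemma forall_lt_two_mul_iff {P : ℕ → Prop} {m : ℕ} (he : ∀ j < m, P (2 * j))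
    (ho : ∀ j < m, P (2 * j + 1)) : ∀ i < 2 * m, P i := by
  intro i hi
  rcases Nat.even_or_odd' i with ⟨k, rfl | rfl⟩
  · exact he k (by omega)
  · exact ho k (by omega)

namespace IsMonicSkewOrthogonal

variable {B : ℂ[X] →ₗ[ℂ] ℂ[X] →ₗ[ℂ] ℂ} {E O E' O' : ℕ → ℂ[X]} {u u' : ℕ → ℂ}

lemma monic_interleave (h : IsMonicSkewOrthogonal (fun f g => B f g) E O u) (n : ℕ) :
    (skewInterleave E O n).Monic := by
  rw [skewInterleave]
  split_ifs
  exacts [h.even_monic _, h.odd_monic _]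

lemma natDegree_interleave (h : IsMonicSkewOrthogonal (fun f g => B f g) E O u) (n : ℕ) :
    (skewInterleave E O n).natDegree = n := by
  rw [skewInterleave]
  split_ifs
  · rw [h.even_natDegree]; omega
  · rw [h.odd_natDegree]; omega

lemma apply_eq_zero_of_degree_lt (h : IsMonicSkewOrthogonal (fun f g => B f g) E O u)
    (φ : ℂ[X] →ₗ[ℂ] ℂ) {m : ℕ} (hE : ∀ j < m, φ (E j) = 0) (hO : ∀ j < m, φ (O j) = 0)
    {f : ℂ[X]} (hf : f.degree < (2 * m : ℕ)) : φ f = 0 := by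
  refine linearMap_eq_zero_of_degree_lt h.monic_interleave h.natDegree_interleave φ
    (forall_lt_two_mul_iff (fun j hj => ?_) fun j hj => ?_) hf
  · rw [skewInterleave_even, hE j hj]
  · rw [skewInterleave_odd, hO j hj]

lemma odd_even (h : IsMonicSkewOrthogonal (fun f g => B f g) E O u)
    (hB : ∀ f g, B f g = -B g f) (m n : ℕ) : B (O m) (E n) = if n = m then -u n else 0 := by
  rw [hB, h.even_odd]
  split_ifs <;> simp

/-- Nondegeneracy in degree below 2m: the Gram matrix of E_0, O_0, E_1, O_1, … consists of 2×2 skew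
blocks with entries ±u_j. -/
lemma eq_zero_of_apply_eq_zero (h : IsMonicSkewOrthogonal (fun f g => B f g) E O u)
    (hB : ∀ f g, B f g = -B g f) (hu : ∀ m, u m ≠ 0) {m : ℕ} {f : ℂ[X]}
    (hf : f.degree < (2 * m : ℕ)) (hE : ∀ j < m, B f (E j) = 0) (hO : ∀ j < m, B f (O j) = 0) :
    f = 0 := by
  set σ : ℕ → ℕ := fun i => if i % 2 = 0 then i + 1 else i - 1
  have hσe (k : ℕ) : σ (2 * k) = 2 * k + 1 := if_pos (by omega)
  have hσo (k : ℕ) : σ (2 * k + 1) = 2 * k := if_neg (by omega)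
  have heo : ∀ m n, B (E m) (O n) = if m = n then u m else 0 := h.even_odd
  have hee : ∀ m n, B (E m) (E n) = 0 := h.even_even
  have hoo : ∀ m n, B (O m) (O n) = 0 := h.odd_odd
  have hoe := h.odd_even hB
  refine eq_zero_of_bilin_eq_zero h.monic_interleave h.natDegree_interleave B σ
    (fun i hi => ?_) ?_ ?_ hf ?_
  · simp only [σ]
    split_ifs <;> omega
  · refine forall_lt_two_mul_iff (fun j _ => ?_) fun j _ => ?_
    · rw [hσe, skewInterleave_even, skewInterleave_odd, heo, if_pos rfl]
      exact hu j
    · rw [hσo, skewInterleave_even, skewInterleave_odd, hoe, if_pos rfl]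
      exact neg_ne_zero.2 (hu j)
  · refine forall_lt_two_mul_iff (fun j _ => ?_) fun j _ => ?_
    · refine forall_lt_two_mul_iff (fun k _ hk => ?_) fun k _ _ => ?_
      · rw [hσe, skewInterleave_even, skewInterleave_odd, heo, if_neg (by omega)]
      · rw [hσe, skewInterleave_odd, skewInterleave_odd, hoo]
    · refine forall_lt_two_mul_iff (fun k _ _ => ?_) fun k _ hk => ?_
      · rw [hσo, skewInterleave_even, skewInterleave_even, hee]
      · rw [hσo, skewInterleave_odd, skewInterleave_even, hoe, if_neg (by omega)]
  · refine forall_lt_two_mul_iff (fun j hj => ?_) fun j hj => ?_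
    · rw [skewInterleave_even, hE j hj]
    · rw [skewInterleave_odd, hO j hj]

lemma degree_even (h : IsMonicSkewOrthogonal (fun f g => B f g) E O u) (m : ℕ) :
    (E m).degree = (2 * m : ℕ) := by
  rw [degree_eq_natDegree (h.even_monic m).ne_zero, h.even_natDegree]

lemma degree_odd (h : IsMonicSkewOrthogonal (fun f g => B f g) E O u) (m : ℕ) :
    (O m).degree = (2 * m + 1 : ℕ) := by
  rw [degree_eq_natDegree (h.odd_monic m).ne_zero, h.odd_natDegree]

/-- E'_m annihilates everything of degree below 2m, by expansion in its own family. Thus E'_m - E_m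
lies in that space and is orthogonal to it. The numbers u' may vanish; only u must not. -/
lemma even_eq (h : IsMonicSkewOrthogonal (fun f g => B f g) E O u)
    (h' : IsMonicSkewOrthogonal (fun f g => B f g) E' O' u')
    (hB : ∀ f g, B f g = -B g f) (hu : ∀ m, u m ≠ 0) (m : ℕ) : E' m = E m := by
  have hlow {f : ℂ[X]} (hf : f.degree < (2 * m : ℕ)) : B (E' m) f = 0 :=
    h'.apply_eq_zero_of_degree_lt (B (E' m)) (fun j _ => h'.even_even m j)
      (fun j hj => (h'.even_odd m j).trans (if_neg hj.ne')) hf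
  rw [← sub_eq_zero]
  refine h.eq_zero_of_apply_eq_zero hB hu (m := m) ?_ (fun j hj => ?_) fun j hj => ?_
  · rw [← h'.degree_even m]
    exact degree_sub_lt_left (by rw [h'.degree_even, h.degree_even]) (h'.even_monic m).ne_zero
      (by rw [h'.even_monic m, h.even_monic m])
  · rw [map_sub, LinearMap.sub_apply, hlow (by rw [h.degree_even]; exact_mod_cast (by omega)),
      (h.even_even m j :), sub_zero]
  · rw [map_sub, LinearMap.sub_apply, hlow (by rw [h.degree_odd]; exact_mod_cast (by omega)),
      (h.even_odd m j :), if_neg hj.ne', sub_zero]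

lemma exists_odd_eq (h : IsMonicSkewOrthogonal (fun f g => B f g) E O u)
    (h' : IsMonicSkewOrthogonal (fun f g => B f g) E' O' u')
    (hB : ∀ f g, B f g = -B g f) (hu : ∀ m, u m ≠ 0) (m : ℕ) :
    ∃ c : ℂ, O' m = O m + C c * E m := by
  have hlow {f : ℂ[X]} (hf : f.degree < (2 * m : ℕ)) : B (O' m) f = 0 :=
    h'.apply_eq_zero_of_degree_lt (B (O' m))
      (fun j hj => (h'.odd_even hB m j).trans (if_neg hj.ne)) (fun j _ => h'.odd_odd m j) hf
  -- O'_m - O_m has degree at most 2m; subtracting this multiple of E_m brings it below 2m, where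
  -- nondegeneracy applies.
  refine ⟨(O' m - O m).coeff (2 * m), ?_⟩
  rw [← sub_eq_zero, ← sub_sub]
  refine h.eq_zero_of_apply_eq_zero hB hu (m := m) ?_ (fun j hj => ?_) fun j hj => ?_
  · have := degree_sub_C_mul_lt h.monic_interleave h.natDegree_interleave (n := 2 * m)
      (f := O' m - O m) ?_
    · rwa [skewInterleave_even] at this
    · rw [← h'.degree_odd m]
      exact degree_sub_lt_left (by rw [h'.degree_odd, h.degree_odd]) (h'.odd_monic m).ne_zero
        (by rw [h'.odd_monic m, h.odd_monic m])
  · rw [← smul_eq_C_mul, map_sub, map_sub, map_smul, LinearMap.sub_apply, LinearMap.sub_apply,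
      LinearMap.smul_apply, hlow (by rw [h.degree_even]; exact_mod_cast (by omega)),
      h.odd_even hB, if_neg hj.ne, (h.even_even m j :), smul_zero, sub_zero, sub_zero]
  · rw [← smul_eq_C_mul, map_sub, map_sub, map_smul, LinearMap.sub_apply, LinearMap.sub_apply,
      LinearMap.smul_apply, hlow (by rw [h.degree_odd]; exact_mod_cast (by omega)),
      (h.odd_odd m j :), (h.even_odd m j :), if_neg hj.ne', smul_zero, sub_zero, sub_zero]

end IsMonicSkewOrthogonal

end SkewUniqueness

/-! ### The mixed form in the basis p_{2k}, q_k and its skew orthogonal polynomials. -/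

section SkewMixed

open Polynomial

variable {a b : ℝ}

lemma jacobiSkewOp_add (a b : ℝ) (f g : ℂ[X]) :
    jacobiSkewOp a b (f + g) = jacobiSkewOp a b f + jacobiSkewOp a b g := by
  simp only [jacobiSkewOp, pearson, derivative_add]
  ring

lemma jacobiSkewOp_smul (a b : ℝ) (r : ℂ) (f : ℂ[X]) :
    jacobiSkewOp a b (r • f) = r • jacobiSkewOp a b f := by
  simp only [jacobiSkewOp, pearson, smul_eq_C_mul, derivative_C_mul]
  ring

/-- The form `⟨f, g⟩_X` as a bilinear map. -/
noncomputable def skewMixedBilin (ha : -1 < a) (hb : -1 < b) (X : ℂ) :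
    ℂ[X] →ₗ[ℂ] ℂ[X] →ₗ[ℂ] ℂ :=
  X ^ 2 • skewOneBilin ha hb + LinearMap.mk₂ ℂ (skewFour a b)
    (fun f f' g => by simp only [skewFour_eq ha hb, add_mul, map_add])
    (fun r f g => by simp only [skewFour_eq ha hb, smul_mul_assoc, map_smul])
    (fun f g g' => by simp only [skewFour_eq ha hb, jacobiSkewOp_add, mul_add, map_add])
    (fun r f g => by simp only [skewFour_eq ha hb, jacobiSkewOp_smul, mul_smul_comm, map_smul])

lemma skewMixedBilin_apply (ha : -1 < a) (hb : -1 < b) (X : ℂ) (f g : ℂ[X]) :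
    skewMixedBilin ha hb X f g = skewMixed a b X f g := rfl

lemma skewFour_swap (a b : ℝ) (f g : ℂ[X]) : skewFour a b f g = -skewFour a b g f := by
  rw [skewFour, skewFour, ← mul_neg, ← integral_neg]
  congr 2
  ext z
  ring

lemma skewMixedBilin_swap (ha : -1 < a) (hb : -1 < b) (X : ℂ) (f g : ℂ[X]) :
    skewMixedBilin ha hb X f g = -skewMixedBilin ha hb X g f := by
  rw [skewMixedBilin_apply, skewMixedBilin_apply, skewMixed, skewMixed, skewOne_swap ha hb,
    skewFour_swap]
  ring

/-- The diagonal coefficient `X² h⁽¹⁾_j + h⁽⁴⁾_{2j} + ζ_j h⁽⁴⁾_{2j-1}`. -/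
noncomputable def skewDiagonal (a b : ℝ) (X : ℂ) (j : ℕ) : ℂ :=
  X ^ 2 * jacobiNormOne a b j + jacobiNormFour a b (2 * j) +
      jacobiZeta a b j * jacobiNormFour a b (2 * j - 1)

lemma skewMixedBilin_even_even (ha : -1 < a) (hb : -1 < b) (X : ℂ) (i j : ℕ) :
    skewMixedBilin ha hb X (jacobiPoly a b (2 * i)) (jacobiPoly a b (2 * j)) = 0 := by
  rw [skewMixedBilin_apply, skewMixed, skewOne_even_even ha hb, skewFour_even_even ha hb]
  simp

lemma jacobiOdd_succ (a b : ℝ) (n : ℕ) :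
    jacobiOdd a b (n + 1) = jacobiPoly a b (2 * (n + 1) + 1) -
      ((jacobiZeta a b (n + 1) : ℝ) : ℂ) • jacobiPoly a b (2 * n + 1) := by
  rw [jacobiOdd, smul_eq_C_mul]
  rfl

lemma jacobiOdd_zero (a b : ℝ) : jacobiOdd a b 0 = jacobiPoly a b (2 * 0 + 1) := rfl

lemma skewFour_jacobiOdd_right (ha : -1 < a) (hb : -1 < b) (f : ℂ[X]) (n : ℕ) :
    skewFour a b f (jacobiOdd a b (n + 1)) =
      skewFour a b f (jacobiPoly a b (2 * (n + 1) + 1)) -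
      (jacobiZeta a b (n + 1) : ℂ) * skewFour a b f (jacobiPoly a b (2 * n + 1)) := by
  -- At X = 0 the mixed form reduces to the second one, which gives its linearity.
  have e (g : ℂ[X]) : skewFour a b f g = skewMixedBilin ha hb 0 f g := by
    rw [skewMixedBilin_apply, skewMixed]; simp
  rw [jacobiOdd_succ, e, e, e, map_sub, map_smul, smul_eq_mul]

lemma skewFour_jacobiOdd_left (ha : -1 < a) (hb : -1 < b) (f : ℂ[X]) (n : ℕ) :
    skewFour a b (jacobiOdd a b (n + 1)) f =
      skewFour a b (jacobiPoly a b (2 * (n + 1) + 1)) f -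
      (jacobiZeta a b (n + 1) : ℂ) * skewFour a b (jacobiPoly a b (2 * n + 1)) f := by
  rw [skewFour_swap, skewFour_jacobiOdd_right ha hb, skewFour_swap a b f, skewFour_swap a b f]
  ring

lemma skewMixedBilin_odd_odd (ha : -1 < a) (hb : -1 < b) (X : ℂ) (i j : ℕ) :
    skewMixedBilin ha hb X (jacobiOdd a b i) (jacobiOdd a b j) = 0 := by
  rw [skewMixedBilin_apply, skewMixed, skewOne_odd_odd ha hb]
  rcases i with _ | i <;> rcases j with _ | j <;>
    simp only [skewFour_jacobiOdd_right ha hb, skewFour_jacobiOdd_left ha hb, jacobiOdd_zero,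
      skewFour_odd_odd ha hb] <;> simp

lemma skewMixedBilin_even_odd (ha : -1 < a) (hb : -1 < b) (X : ℂ) (i j : ℕ) :
    skewMixedBilin ha hb X (jacobiPoly a b (2 * i)) (jacobiOdd a b j) =
      (if i = j then skewDiagonal a b X j else 0) -
      (if i = j + 1 then (jacobiNormFour a b (2 * j + 1) : ℂ) else 0) -
      (if i + 1 = j then (jacobiZeta a b j : ℂ) * jacobiNormFour a b (2 * i) else 0) := by
  rw [skewMixedBilin_apply, skewMixed, skewOne_even_odd ha hb]
  rcases j with _ | j
  · rw [jacobiOdd_zero, skewFour_even_odd ha hb]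
    by_cases h : i = 0
    · subst h
      simp [skewDiagonal, jacobiZeta]
    · by_cases h1 : i = 1
      · subst h1; simp
      · simp [h, h1]
  · rw [skewFour_jacobiOdd_right ha hb, skewFour_even_odd ha hb, skewFour_even_odd ha hb]
    by_cases h : i = j + 1
    · subst h
      simp [skewDiagonal, mul_add]
      ring
    · by_cases h1 : i = j + 2
      · subst h1
        simp
      · by_cases h2 : i = j
        · subst h2; simp [show ¬i = i + 1 + 1 by omega]
        · simp [h, h1, h2]

lemma skewPolyEven_eq (a b : ℝ) (X : ℂ) (m : ℕ) :
    skewPolyEven a b X m = (1 / jacobiAlpha a b X m) •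
      ∑ k ∈ Finset.range (m + 1), jacobiAlpha a b X k • jacobiPoly a b (2 * k) := by
  simp only [skewPolyEven, smul_eq_C_mul]

lemma skewPolyOdd_eq (a b : ℝ) (X : ℂ) (m : ℕ) :
    skewPolyOdd a b X m = (1 / jacobiXi a b X m) •
      ∑ k ∈ Finset.range (m + 1), jacobiXi a b X k • jacobiOdd a b k := by
  simp only [skewPolyOdd, smul_eq_C_mul]

/-- For n < m the column of q_n meets all terms of the recurrence and gives 0. For n = m the term
with A_{m+1} is cut off by the truncation, and minus that missing term is what remains; this is the
source of u_m. -/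
lemma skewMixedBilin_sum_jacobiOdd (ha : -1 < a) (hb : -1 < b) {X : ℂ} {A : ℕ → ℂ}
    (hA : EvenRecurrence a b X A) {m n : ℕ} (hnm : n ≤ m) :
    skewMixedBilin ha hb X (∑ k ∈ Finset.range (m + 1), A k • jacobiPoly a b (2 * k))
      (jacobiOdd a b n) =
      if n = m then (jacobiNormFour a b (2 * m + 1) : ℂ) * A (m + 1) else 0 := by
  rw [map_sum, LinearMap.sum_apply]
  simp only [map_smul, LinearMap.smul_apply, smul_eq_mul, skewMixedBilin_even_odd, mul_sub,
    mul_ite, mul_zero, Finset.sum_sub_distrib, Finset.sum_ite_eq', Finset.mem_range]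
  rcases n with _ | n
  · have h0 := hA.1
    simp only [Nat.add_eq_zero_iff, one_ne_zero, and_false, if_false, Finset.sum_const_zero]
    by_cases h : 0 = m
    · subst h
      simp [skewDiagonal, jacobiZeta]
      linear_combination -h0
    · rw [if_pos (by omega), if_pos (by omega), if_neg h]
      simp [skewDiagonal, jacobiZeta]
      linear_combination -h0
  · have h1 := hA.2 n
    simp only [Nat.add_right_cancel_iff, Finset.sum_ite_eq', Finset.mem_range]
    rw [if_pos (by omega), if_pos (show n < m + 1 by omega), skewDiagonal]
    by_cases h : n + 1 = m
    · subst h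
      simp [mul_add]
      linear_combination -h1
    · rw [if_pos (by omega), if_neg h]
      simp [mul_add]
      linear_combination -h1

/-- The same along rows. Strict inequality m < n keeps the whole recurrence inside the sum; the
remaining pairs are covered by the column version. -/
lemma skewMixedBilin_jacobiPoly_sum (ha : -1 < a) (hb : -1 < b) {X : ℂ} {A : ℕ → ℂ}
    (hA : OddRecurrence a b X A) {m n : ℕ} (hmn : m < n) :
    skewMixedBilin ha hb X (jacobiPoly a b (2 * m))
      (∑ k ∈ Finset.range (n + 1), A k • jacobiOdd a b k) = 0 := by
  rw [map_sum]
  simp only [map_smul, smul_eq_mul, skewMixedBilin_even_odd, mul_sub,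
    mul_ite, mul_zero, Finset.sum_sub_distrib, Finset.sum_ite_eq, Finset.mem_range]
  rw [if_pos (by omega), if_pos (by omega), skewDiagonal]
  rcases m with _ | m
  · have h0 := hA.1
    simp [jacobiZeta] at h0 ⊢
    linear_combination -h0
  · have h1 := hA.2 m
    simp only [Nat.add_right_cancel_iff, Finset.sum_ite_eq, Finset.mem_range]
    rw [if_pos (by omega)]
    simp [mul_add] at h1 ⊢
    linear_combination -h1

lemma monic_natDegree_normalized_sum {P : ℕ → ℂ[X]} {d : ℕ → ℕ} (hd : StrictMono d)
    (hm : ∀ k, (P k).Monic) (hP : ∀ k, (P k).natDegree = d k) {c : ℕ → ℂ} {m : ℕ}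
    (hc : c m ≠ 0) :
    ((1 / c m) • ∑ k ∈ Finset.range (m + 1), c k • P k).Monic ∧
      ((1 / c m) • ∑ k ∈ Finset.range (m + 1), c k • P k).natDegree = d m := by
  have hlt : ((1 / c m) • ∑ k ∈ Finset.range m, c k • P k).degree < (P m).degree := by
    refine (degree_smul_le _ _).trans_lt ?_
    rw [degree_eq_natDegree (hm m).ne_zero, hP]
    refine (degree_sum_le _ _).trans_lt ((Finset.sup_lt_iff (WithBot.bot_lt_coe _)).2 ?_)
    intro k hk
    refine (degree_smul_le _ _).trans_lt (degree_le_natDegree.trans_lt ?_)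
    rw [hP]
    exact_mod_cast hd (Finset.mem_range.1 hk)
  rw [Finset.sum_range_succ, smul_add, smul_smul, one_div_mul_cancel hc, one_smul]
  exact ⟨(hm m).add_of_right hlt, by rw [natDegree_add_eq_right_of_degree_lt hlt, hP]⟩

lemma monic_natDegree_jacobiOdd (ha : -1 < a) (hb : -1 < b) (n : ℕ) :
    (jacobiOdd a b n).Monic ∧ (jacobiOdd a b n).natDegree = 2 * n + 1 := by
  rcases n with _ | n
  · exact ⟨monic_jacobiPoly ha hb _, natDegree_jacobiPoly ha hb _⟩
  · have hlt : (-(((jacobiZeta a b (n + 1) : ℝ) : ℂ) • jacobiPoly a b (2 * n + 1))).degree <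
        (jacobiPoly a b (2 * (n + 1) + 1)).degree := by
      rw [degree_neg, degree_eq_natDegree (monic_jacobiPoly ha hb _).ne_zero,
        natDegree_jacobiPoly ha hb]
      refine (degree_smul_le _ _).trans_lt (degree_le_natDegree.trans_lt ?_)
      rw [natDegree_jacobiPoly ha hb]
      exact_mod_cast (by omega)
    rw [jacobiOdd_succ, sub_eq_add_neg]
    exact ⟨(monic_jacobiPoly ha hb _).add_of_left hlt,
      by rw [natDegree_add_eq_left_of_degree_lt hlt, natDegree_jacobiPoly ha hb]⟩

lemma jacobiXi_ne_zero (ha : -1 < a) (hb : -1 < b) {X : ℂ} {m : ℕ}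
    (h : jacobiAlpha a b X m ≠ 0) : jacobiXi a b X m ≠ 0 := by
  have hm : (0 : ℝ) ≤ m := m.cast_nonneg
  have h1 := Complex.ofReal_ne_zero.2 (show 4 * (m : ℝ) + a + b + 2 ≠ 0 by linarith)
  have h2 := Complex.ofReal_ne_zero.2 (show a + b + 2 ≠ 0 by linarith)
  push_cast at h1 h2
  exact div_ne_zero (mul_ne_zero h h1) h2

lemma isMonicSkewOrthogonal_skewPoly (ha : -1 < a) (hb : -1 < b) {X : ℂ}
    (h : ∀ j, jacobiAlpha a b X j ≠ 0) :
    IsMonicSkewOrthogonal (fun f g => skewMixedBilin ha hb X f g) (skewPolyEven a b X)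
      (skewPolyOdd a b X)
      (fun m => jacobiNormFour a b (2 * m + 1) * jacobiAlpha a b X (m + 1) /
        jacobiAlpha a b X m) := by
  have hE (m : ℕ) := monic_natDegree_normalized_sum (d := fun k => 2 * k)
    (fun i j hij => by simpa using hij) (fun k => monic_jacobiPoly ha hb (2 * k))
    (fun k => natDegree_jacobiPoly ha hb (2 * k)) (h m)
  have hO (m : ℕ) := monic_natDegree_normalized_sum (d := fun k => 2 * k + 1)
    (fun i j hij => by simpa using hij) (fun k => (monic_natDegree_jacobiOdd ha hb k).1)
    (fun k => (monic_natDegree_jacobiOdd ha hb k).2) (jacobiXi_ne_zero ha hb (h m))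
  simp only [← skewPolyEven_eq, ← skewPolyOdd_eq] at hE hO
  refine ⟨fun m => (hE m).1, fun m => (hE m).2, fun m => (hO m).1, fun m => (hO m).2,
    fun m n => ?_, fun m n => ?_, fun m n => ?_⟩
  · rw [skewPolyEven_eq, skewPolyOdd_eq, map_smul, map_smul, LinearMap.smul_apply]
    -- For m < n each p_{2k} with k ≤ m is orthogonal to the odd sum; for m ≥ n the even sum is
    -- orthogonal to each q_k with k ≤ n, except k = m.
    rcases lt_or_ge m n with hmn | hmn
    · rw [if_neg hmn.ne, map_sum (skewMixedBilin ha hb X), LinearMap.sum_apply, Finset.sum_eq_zero, smul_zero, smul_zero]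
      intro k hk
      rw [map_smul, LinearMap.smul_apply, skewMixedBilin_jacobiPoly_sum ha hb
        (oddRecurrence_jacobiXi ha hb X), smul_zero]
      have := Finset.mem_range.1 hk
      omega
    · have key : ∀ k ∈ Finset.range (n + 1), skewMixedBilin ha hb X
          (∑ k ∈ Finset.range (m + 1), jacobiAlpha a b X k • jacobiPoly a b (2 * k))
          (jacobiXi a b X k • jacobiOdd a b k) = if k = m then
            jacobiXi a b X m * ((jacobiNormFour a b (2 * m + 1) : ℂ) * jacobiAlpha a b X (m + 1))
          else 0 := by
        intro k hk
        have := Finset.mem_range.1 hk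
        rw [map_smul, skewMixedBilin_sum_jacobiOdd ha hb (evenRecurrence_jacobiAlpha ha hb X)
          (by omega), smul_eq_mul]
        split_ifs with hkm
        · rw [hkm]
        · rw [mul_zero]
      rw [map_sum, Finset.sum_congr rfl key, Finset.sum_ite_eq']
      by_cases hmn' : m = n
      · subst hmn'
        have := jacobiXi_ne_zero ha hb (h m)
        rw [if_pos (Finset.self_mem_range_succ m), if_pos rfl, smul_eq_mul, smul_eq_mul]
        field_simp
      · rw [if_neg (by simp; omega), if_neg hmn']
        simp
  · rw [skewPolyEven_eq, skewPolyEven_eq]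
    simp [skewMixedBilin_even_even]
  · rw [skewPolyOdd_eq, skewPolyOdd_eq]
    simp [skewMixedBilin_odd_odd]

end SkewMixed

theorem mainTheorem6 (a b : ℝ) (ha : -1 < a) (hb : -1 < b) (X : ℂ) :
    -- the relations between the Jacobi polynomials and the two skew inner products
    (∀ m n : ℕ,
      skewOne a b (jacobiPoly a b (2 * m)) (jacobiOdd a b n) =
          (if m = n then (jacobiNormOne a b n : ℂ) else 0) ∧
      skewOne a b (jacobiPoly a b (2 * m)) (jacobiPoly a b (2 * n)) = 0 ∧
      skewOne a b (jacobiOdd a b m) (jacobiOdd a b n) = 0 ∧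
      skewFour a b (jacobiPoly a b (2 * m)) (jacobiPoly a b (2 * n + 1)) =
          (if m = n then (jacobiNormFour a b (2 * n) : ℂ)
            else if m = n + 1 then -(jacobiNormFour a b (2 * n + 1) : ℂ) else 0) ∧
      skewFour a b (jacobiPoly a b (2 * m)) (jacobiPoly a b (2 * n)) = 0 ∧
      skewFour a b (jacobiPoly a b (2 * m + 1)) (jacobiPoly a b (2 * n + 1)) = 0) ∧
    -- the closed forms solve the recurrences; normalised to `1` at `j = 0` they are the solutions
    jacobiAlpha a b X 0 = ((Real.Gamma (a + b + 2) / Real.Gamma (b + 1) : ℝ) : ℂ) ∧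
    jacobiXi a b X 0 = ((Real.Gamma (a + b + 2) / Real.Gamma (b + 1) : ℝ) : ℂ) ∧
    (∀ A : ℕ → ℂ, (A 0 = 1 ∧ EvenRecurrence a b X A) ↔
      ∀ j, A j = jacobiAlpha a b X j / jacobiAlpha a b X 0) ∧
    (∀ A : ℕ → ℂ, (A 0 = 1 ∧ OddRecurrence a b X A) ↔
      ∀ j, A j = jacobiXi a b X j / jacobiXi a b X 0) ∧
    -- the Wilson polynomial as a hypergeometric series
    (∀ j : ℕ, jacobiWilson a b X j =
      hypergeometric4F3 (-(j : ℂ)) (j + (a + b + 1) / 2) ((a + 1 - X) / 2) ((a + 1 + X) / 2)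
        ((a + 1) / 2) ((a + 2) / 2) ((a + b + 2) / 2) 1) ∧
    -- the second closed form of the odd coefficients
    (∀ j : ℕ, jacobiXi a b X j =
      ((((2 : ℝ) ^ (2 * j))⁻¹ * Real.Gamma (4 * j + a + b + 3) /
        (((2 * j).factorial : ℝ) * Real.Gamma (2 * j + b + 1) * (a + b + 2)) : ℝ) : ℂ) *
        jacobiWilson a b X j) ∧
    -- for real `X` no coefficient vanishes
    (X.im = 0 → ∀ j, jacobiAlpha a b X j ≠ 0) ∧
    -- the skew orthogonal polynomials
    ((∀ j, jacobiAlpha a b X j ≠ 0) →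
      IsMonicSkewOrthogonal (skewMixed a b X) (skewPolyEven a b X) (skewPolyOdd a b X)
        (fun m => jacobiNormFour a b (2 * m + 1) * jacobiAlpha a b X (m + 1) /
          jacobiAlpha a b X m) ∧
      ∀ (E O : ℕ → Polynomial ℂ) (u : ℕ → ℂ), IsMonicSkewOrthogonal (skewMixed a b X) E O u →
        ∀ m, E m = skewPolyEven a b X m ∧
          ∃ c : ℂ, O m = skewPolyOdd a b X m + Polynomial.C c * skewPolyEven a b X m) := by
  refine ⟨fun m n => ⟨skewOne_even_odd ha hb m n, skewOne_even_even ha hb m n,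
    skewOne_odd_odd ha hb m n, skewFour_even_odd ha hb m n, skewFour_even_even ha hb m n,
    skewFour_odd_odd ha hb m n⟩, jacobiAlpha_zero a b X,
    (jacobiXi_zero ha hb X).trans (jacobiAlpha_zero a b X), evenRecurrence_iff ha hb X,
    oddRecurrence_iff ha hb X, jacobiWilson_eq_hypergeometric a b X, jacobiXi_eq ha hb X,
    fun hX j => ?_, fun h => ?_⟩
  · have e : X = (X.re : ℂ) := Complex.ext rfl (by simpa using hX)
    rw [e]
    exact jacobiAlpha_ne_zero_of_real ha hb X.re j
  · have hQ := isMonicSkewOrthogonal_skewPoly ha hb h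
    have hu (m : ℕ) : (jacobiNormFour a b (2 * m + 1) : ℂ) * jacobiAlpha a b X (m + 1) /
        jacobiAlpha a b X m ≠ 0 :=
      div_ne_zero (mul_ne_zero (Complex.ofReal_ne_zero.2 (jacobiNormFour_pos ha hb _).ne')
        (h _)) (h _)
    refine ⟨hQ, fun E O u hEO m => ?_⟩
    -- The bilinear map agrees with the form by definition, so the hypothesis transfers unchanged.
    have hEO' : IsMonicSkewOrthogonal (fun f g => skewMixedBilin ha hb X f g) E O u := hEO
    exact ⟨hQ.even_eq hEO' (skewMixedBilin_swap ha hb X) hu m,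
      hQ.exists_odd_eq hEO' (skewMixedBilin_swap ha hb X) hu m⟩
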